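/- Conventions. A graph is a finite cell complex of dimension at most $1$ (loops and multiple edges are allowed). Let $\Gamma$ be a finite connected graph with vertex set $V(\Gamma)$. A vertex $b$ separates $a$ from $c$ if $b\in\{a,c\}$ or if $a$ and $c$ lie in different connected components of the topological space $\Gamma\setminus\{b\}$. A cut-vertex is a vertex whose removal disconnects the space, and a bridge is an edge such that the removal of its interior disconnects $\Gamma$. A connected graph is inseparable if it has no cut-vertex. A block is a maximal inseparable subgraph, and a brick is a block which has at least one edge and is not a bridge (taken with its ends). The brick-vertex tree $\mathcal{BV}(\Gamma)$ is the tree with vertex set $V(\Gamma)\sqcup\{\text{bricks of }\Gamma\}$ whose edges are the bridges of $\Gamma$ and the edges joining each brick (seen as a new vertex, called a brick-vertex) to each of the vertices of $\Gamma$ lying in this brick. For $X\subseteq V(\Gamma)$, the convex hull $\mathrm{Conv}(X)$ is the union of the segments of $\mathcal{BV}(\Gamma)$ joining the elements of $X$ pairwise. For a finite set $X$, an $X$-tree is a finite tree whose set of vertices contains $X$ and whose vertices of valency at most $2$ all belong to $X$. An isomorphism of $X$-trees is an isomorphism of trees that fixes each element of $X$. A tree hull of a finite metric space $(X,\delta)$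 is an $X$-tree whose edges can be given positive lengths such that $\delta(x,y)$ is, for all $x,y\in X$, the length of the segment joining $x$ and $y$. The convex hull $\mathrm{Conv}(X)$ is seen as an $X$-tree by no longer considering as vertices its points of valency $2$ (in $\mathrm{Conv}(X)$) which are not in $X$. Theorem 10.1. Let $\Gamma$ be a finite connected graph and $\delta$ a distance on $V(\Gamma)$ such that, for all $a,b,c\in V(\Gamma)$, one has $\delta(a,b)+\delta(b,c)=\delta(a,c)$ if and only if $b$ separates $a$ from $c$ in $\Gamma$. Let $X$ be a nonempty set of vertices of $\Gamma$ such that $\mathrm{Conv}(X)$ contains no brick-vertex whose valency in $\mathrm{Conv}(X)$ is at least $4$. Then $\delta$ satisfies the four points condition on $X$, that is, $$\delta(a,b)+\delta(c,d)\le\max\{\delta(a,c)+\delta(b,d),\ \delta(a,d)+\delta(b,c)\}\quad\text{for all } a,b,c,d\in X,$$ and the tree hull of $(X,\delta)$ is isomorphic to $\mathrm{Conv}(X)$ as an $X$-tree: $\mathrm{Conv}(X)$ is itself a tree hull of $(X,\delta)$, and every tree hull of $(X,\delta)$ is isomorphic to it as an $X$-tree. -/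

import Mathlib

open scoped Graph

universe uα uβ uX uW uW'

namespace BrickVertex

section Multigraph

variable {α : Type uα} {β : Type uβ}

/-- A multigraph (loops and parallel edges allowed) is seen as a cell complex of dimension at
most `1`: its cells are its vertices (points) and its edges (open arcs). -/
def cells (G : Graph α β) : Set (α ⊕ β) :=
  Sum.inl '' V(G) ∪ Sum.inr '' E(G)

/-- Incidence between the cells that belong to `S`: an open edge of `S` is joined to those of its
end vertices that belong to `S`.  The connected components of the union of the cells of `S`,
a subspace of the topological realization of `G`, are the connected components of this graph
on `S`. -/
def cellGraph (G : Graph α β) (S : Set (α ⊕ β)) : SimpleGraph (α ⊕ β) :=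
  SimpleGraph.fromRel fun p q => p ∈ S ∧ q ∈ S ∧ ∃ x e, p = Sum.inl x ∧ q = Sum.inr e ∧ G.Inc e x

/-- Any two cells of `S` are in the same connected component of the union of the cells of `S`. -/
def PreconnectedOn (G : Graph α β) (S : Set (α ⊕ β)) : Prop :=
  ∀ p ∈ S, ∀ q ∈ S, (cellGraph G S).Reachable p q

/-- A (nonempty) connected graph. -/
def IsConnected (G : Graph α β) : Prop :=
  V(G).Nonempty ∧ PreconnectedOn G (cells G)

/-- A cut-vertex is a vertex whose removal (of the point only, the open edges at it are kept)
disconnects the space `G`. -/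
def IsCutVertex (G : Graph α β) (v : α) : Prop :=
  v ∈ V(G) ∧ ¬ PreconnectedOn G (cells G \ {Sum.inl v})

/-- A bridge is an edge such that the removal of its interior disconnects the space `G`. -/
def IsBridge (G : Graph α β) (e : β) : Prop :=
  e ∈ E(G) ∧ ¬ PreconnectedOn G (cells G \ {Sum.inr e})

/-- The vertex `b` separates `a` from `c`: either `b ∈ {a, c}`, or `a` and `c` are in different
connected components of the space `G` deprived of the point `b`. -/
def Separates (G : Graph α β) (b a c : α) : Prop :=
  b = a ∨ b = c ∨ ¬ (cellGraph G (cells G \ {Sum.inl b})).Reachable (Sum.inl a) (Sum.inl c)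

/-- A connected graph without cut-vertices. -/
def Inseparable (G : Graph α β) : Prop :=
  IsConnected G ∧ ∀ v, ¬ IsCutVertex G v

/-- A block of `G` is a maximal inseparable subgraph of `G`. -/
def IsBlock (G H : Graph α β) : Prop :=
  Maximal (fun K : Graph α β => K ≤ G ∧ Inseparable K) H

/-- A brick of `G` is a block which is not a bridge (seen as a subgraph: the edge with its
two ends).  The condition `E(H).Nonempty` only says that the graph with one vertex and no edge,
being a tree, has no brick. -/
def IsBrick (G H : Graph α β) : Prop :=
  IsBlock G H ∧ E(H).Nonempty ∧ ¬ ∃ e, IsBridge G e ∧ E(H) = {e}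

/-- The vertices of the brick-vertex tree: the vertices of `G` and one brick-vertex for
each brick of `G`. -/
abbrev BVVertex (G : Graph α β) : Type (max uα uβ) :=
  V(G) ⊕ {H : Graph α β // IsBrick G H}

/-- The brick-vertex tree of `G`.  Its edges are the bridges of `G` and the edges joining each
brick-vertex to the vertices of the corresponding brick.  (Bridges are neither loops nor parallel
to other edges, and `SimpleGraph.fromRel` symmetrizes the relation.) -/
def bvTree (G : Graph α β) : SimpleGraph (BVVertex G) :=
  SimpleGraph.fromRel fun p q =>
    match p, q with
    | Sum.inl u, Sum.inl v => ∃ e, IsBridge G e ∧ G.IsLink e u v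
    | Sum.inl u, Sum.inr b => (u : α) ∈ V(b.1)
    | Sum.inr _, _ => False

end Multigraph

section Trees

variable {W : Type uW}

/-- The valency of a vertex (used only for finite graphs). -/
noncomputable def valency (T : SimpleGraph W) (w : W) : ℕ :=
  (T.neighborSet w).ncard

/-- The convex hull of a set `S` of vertices of a tree: the union of the segments (paths) joining
pairwise the elements of `S`, as a subgraph. -/
def convexHull (T : SimpleGraph W) (S : Set W) : T.Subgraph where
  verts := {w | ∃ x ∈ S, ∃ y ∈ S, ∃ p : T.Walk x y, p.IsPath ∧ w ∈ p.support}
  Adj u v := ∃ x ∈ S, ∃ y ∈ S, ∃ p : T.Walk x y, p.IsPath ∧ s(u, v) ∈ p.edges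
  adj_sub := by
    rintro u v ⟨x, -, y, -, p, -, h⟩
    exact p.adj_of_mem_edges h
  edge_vert := by
    rintro u v ⟨x, hx, y, hy, p, hp, h⟩
    exact ⟨x, hx, y, hy, p, hp, p.fst_mem_support_of_mem_edges h⟩
  symm := ⟨by
    rintro u v ⟨x, hx, y, hy, p, hp, h⟩
    exact ⟨x, hx, y, hy, p, hp, by rwa [Sym2.eq_swap]⟩⟩

theorem subset_convexHull (T : SimpleGraph W) (S : Set W) {x : W} (hx : x ∈ S) :
    x ∈ (convexHull T S).verts :=
  ⟨x, hx, x, hx, SimpleGraph.Walk.nil, SimpleGraph.Walk.IsPath.nil, by simp⟩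

/-- The vertices of a tree that remain when all the vertices of valency `2` which are not in `S`
are forgotten. -/
def keptVertices (T : SimpleGraph W) (S : Set W) : Set W :=
  {w | w ∈ S ∨ valency T w ≠ 2}

/-- The same topological tree, in which the vertices of valency `2` outside `S` are
no longer considered as vertices: two remaining vertices are joined by an edge when
they are the ends of a segment of `T` that has no other remaining vertex on it. -/
def smoothing (T : SimpleGraph W) (S : Set W) : SimpleGraph (keptVertices T S) where
  Adj u v := u ≠ v ∧ ∃ p : T.Walk (u : W) (v : W), p.IsPath ∧
    ∀ w ∈ p.support, w ∈ keptVertices T S → w = u ∨ w = v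
  symm := ⟨by
    rintro u v ⟨h, p, hp, hw⟩
    refine ⟨h.symm, p.reverse, hp.reverse, fun w h1 h2 => ?_⟩
    rw [SimpleGraph.Walk.support_reverse, List.mem_reverse] at h1
    exact (hw w h1 h2).symm⟩
  loopless := ⟨fun _ h => h.1 rfl⟩

/-- An `X`-tree: a finite tree whose set of vertices contains `X` (through the injection `ι`)
and all of whose vertices of valency at most `2` belong to `X`. -/
structure IsXTree {X : Type uX} (T : SimpleGraph W) (ι : X → W) : Prop where
  finite : Finite W
  isTree : T.IsTree
  injective : Function.Injective ι
  mem_range : ∀ w, valency T w ≤ 2 → w ∈ Set.range ι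

/-- The distance of `X` is induced by the length function `ℓ` on the edges of `T`: the lengths are
positive and the distance of two elements of `X` is the length of the segment joining them. -/
def InducesDist {X : Type uX} [MetricSpace X] (T : SimpleGraph W) (ι : X → W)
    (ℓ : Sym2 W → ℝ) : Prop :=
  (∀ e ∈ T.edgeSet, 0 < ℓ e) ∧
    ∀ x y : X, ∀ p : T.Walk (ι x) (ι y), p.IsPath → dist x y = (p.edges.map ℓ).sum

/-- `T`, marked by `ι`, is a tree hull of the finite metric space `X`: an `X`-tree with a length
function that induces the distance of `X`. -/
def IsTreeHull (X : Type uX) [MetricSpace X] (T : SimpleGraph W) (ι : X → W) : Prop :=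
  IsXTree T ι ∧ ∃ ℓ : Sym2 W → ℝ, InducesDist T ι ℓ

/-- Isomorphism of `X`-trees: an isomorphism of trees that fixes `X`. -/
def XTreeIso {X : Type uX} {W' : Type uW'} (T : SimpleGraph W) (ι : X → W)
    (T' : SimpleGraph W') (ι' : X → W') : Prop :=
  ∃ φ : T ≃g T', ∀ x, φ (ι x) = ι' x

/-- The four points condition. -/
def FourPointsCondition (X : Type uX) [MetricSpace X] : Prop :=
  ∀ a b c d : X, dist a b + dist c d ≤ max (dist a c + dist b d) (dist a d + dist b c)

end Trees

section Hull

variable {α : Type uα} {β : Type uβ}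

/-- The convex hull of a set `X` of vertices of `G` in the brick-vertex tree of `G`. -/
def bvHull (G : Graph α β) (X : Set V(G)) : (bvTree G).Subgraph :=
  convexHull (bvTree G) (Sum.inl '' X)

/-- The elements of `X` among the vertices of the hull. -/
def hullMarks (G : Graph α β) (X : Set V(G)) : Set (bvHull G X).verts :=
  {w | (w : BVVertex G) ∈ Sum.inl '' X}

/-- The hull as an `X`-tree: its vertices are the elements of `X` and the vertices
whose valency in the hull is not `2`. -/
def hullTree (G : Graph α β) (X : Set V(G)) :
    SimpleGraph (keptVertices (bvHull G X).coe (hullMarks G X)) :=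
  smoothing (bvHull G X).coe (hullMarks G X)

/-- The inclusion of `X` in the set of vertices of `hullTree G X`. -/
def hullMark (G : Graph α β) (X : Set V(G)) (x : X) :
    keptVertices (bvHull G X).coe (hullMarks G X) :=
  ⟨⟨Sum.inl x.1, subset_convexHull _ _ ⟨x.1, x.2, rfl⟩⟩, Or.inl ⟨x.1, x.2, rfl⟩⟩

end Hull

end BrickVertex

/-!
Why the theorem is true.  In the brick-vertex tree, two different neighbors of a vertex `b` of the
graph lie in different connected components of the complement of `b`
(`BrickVertex.eq_of_adj_of_reachable`): otherwise the union of the two bricks or bridges and of a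
path joining them outside `b` would be an inseparable subgraph
(`BrickVertex.exists_inseparable_ge`), against the maximality of bricks or the fact that a
bridge is the only edge of an inseparable subgraph (`BrickVertex.IsBridge.eq_of_inseparable`). As
a walk of the brick-vertex tree that avoids `b` stays in one component of the complement of `b`,
the brick-vertex tree has no cycle, and the vertices of the graph lying on a segment of it separate
the ends of this segment, so that `δ` is additive along the segment.

It remains to distribute the distance of two vertices `u`, `v` of a brick on the edges joining them
to the brick-vertex. In the hull a brick-vertex has at most three neighbors, none of which
separates two others, so that the strict triangle inequality makes the three Gromov products
positive and they are the lengths sought (`BrickVertex.exists_star_lengths`). With at least four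
neighbors there would be too many conditions. A bridge gets the distance of its ends as length, and
the hull then induces `δ` on `X`.

The rest is about trees with lengths, which are handled through their metric: betweenness and
medians (`BrickVertex.IsTreeMetric`). Such a metric has the four points property, and joining the
pairs of points with nothing in between gives back the tree
(`BrickVertex.segmentGraph_treeDist`). The vertices that survive in `BrickVertex.smoothing` form a
subset closed under medians, whose segment graph is therefore again a tree, with the same
metric. In a tree hull every vertex is a median of three points of `X`, and the distances from a
median to the points of `X` are determined by `δ`
(`BrickVertex.IsTreeMetric.exists_isometry`), whence the uniqueness of the tree hull.
-/

namespace BrickVertex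

/-! ### Tree metrics -/

section TreeMetric

variable {W : Type uW} {d : W → W → ℝ}

/-- Metric betweenness: `b` lies on a geodesic from `a` to `c`. -/
def Btw (d : W → W → ℝ) (a b c : W) : Prop :=
  d a b + d b c = d a c

/-- A description, for finite `W`, of the metrics that come from positive lengths on the edges of
a tree with vertex set `W` (or on a part of its vertices closed under medians), without reference
to the tree: any three points have a median (a point lying between any two of them), and two
geodesics whose overlap is a nontrivial segment can be glued. -/
structure IsTreeMetric (d : W → W → ℝ) : Prop where
  self (x : W) : d x x = 0
  symm (x y : W) : d x y = d y x
  triangle (x y z : W) : d x z ≤ d x y + d y z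
  eq_of_eq_zero (x y : W) : d x y = 0 → x = y
  exists_median (x y z : W) : ∃ m, Btw d x m y ∧ Btw d y m z ∧ Btw d x m z
  chain (a b c e : W) : Btw d a b c → Btw d b c e → b ≠ c → Btw d a c e

namespace IsTreeMetric

theorem nonneg (hd : IsTreeMetric d) (x y : W) : 0 ≤ d x y := by
  have h1 := hd.triangle x y x
  have h2 := hd.symm x y
  have h3 := hd.self x
  linarith

theorem pos (hd : IsTreeMetric d) {x y : W} (h : x ≠ y) : 0 < d x y :=
  lt_of_le_of_ne (hd.nonneg x y) fun h0 => h (hd.eq_of_eq_zero x y h0.symm)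

theorem btw_symm (hd : IsTreeMetric d) {a b c : W} (h : Btw d a b c) : Btw d c b a := by
  unfold Btw at *
  rw [hd.symm c b, hd.symm b a, hd.symm c a]
  linarith

theorem btw_left (hd : IsTreeMetric d) (a c : W) : Btw d a a c := by
  unfold Btw
  rw [hd.self, zero_add]

theorem btw_right (hd : IsTreeMetric d) (a c : W) : Btw d a c c := by
  unfold Btw
  rw [hd.self, add_zero]

theorem btw_trans_left (hd : IsTreeMetric d) {a b c e : W} (h : Btw d a b c) (h' : Btw d a c e) :
    Btw d a b e := by
  unfold Btw at *
  linarith [hd.triangle a b e, hd.triangle b c e]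

theorem btw_trans_right (hd : IsTreeMetric d) {a b c e : W} (h : Btw d a b c) (h' : Btw d a c e) :
    Btw d b c e := by
  unfold Btw at *
  linarith [hd.triangle a b e, hd.triangle b c e]

theorem eq_of_btw_btw (hd : IsTreeMetric d) {a b c : W} (h : Btw d a b c) (h' : Btw d a c b) :
    b = c := by
  unfold Btw at *
  apply hd.eq_of_eq_zero
  linarith [hd.symm b c]

theorem chain_left (hd : IsTreeMetric d) {a b c e : W} (h : Btw d a b c) (h' : Btw d b c e)
    (hbc : b ≠ c) : Btw d a b e :=
  hd.btw_trans_left h (hd.chain a b c e h h' hbc)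

/-- A geodesic from `t` to a point `m` between `y` and `z` can be continued towards `y`
or towards `z`. -/
theorem btw_or_btw (hd : IsTreeMetric d) {y m z : W} (h : Btw d y m z) (t : W) :
    Btw d t m y ∨ Btw d t m z := by
  obtain ⟨q, h1, h2, h3⟩ := hd.exists_median t y m
  by_cases hq : q = m
  · exact Or.inl (hq ▸ h1)
  · exact Or.inr (hd.chain t q m z h3 (hd.btw_trans_right h2 h) hq)

theorem four_points (hd : IsTreeMetric d) (a b c e : W) :
    d a b + d c e ≤ max (d a c + d b e) (d a e + d b c) := by
  obtain ⟨m, hab, hbc, hac⟩ := hd.exists_median a b c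
  have hce := hd.triangle c m e
  have h1 := hd.symm m a
  have h2 := hd.symm m b
  have h3 := hd.symm m c
  have h4 := hd.symm m e
  unfold Btw at hab hbc hac
  rcases hd.btw_or_btw hab e with h | h <;> unfold Btw at h
  · refine le_max_of_le_right ?_
    linarith [hd.symm a e]
  · refine le_max_of_le_left ?_
    linarith [hd.symm b e]

theorem restrict (hd : IsTreeMetric d) (K : Set W)
    (hK : ∀ x ∈ K, ∀ y ∈ K, ∀ z ∈ K, ∀ m, Btw d x m y → Btw d y m z → Btw d x m z → m ∈ K) :
    IsTreeMetric fun a b : K => d a b where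
  self x := hd.self x
  symm x y := hd.symm x y
  triangle x y z := hd.triangle x y z
  eq_of_eq_zero x y h := Subtype.ext (hd.eq_of_eq_zero x y h)
  exists_median x y z := by
    obtain ⟨m, h1, h2, h3⟩ := hd.exists_median x y z
    exact ⟨⟨m, hK x x.2 y y.2 z z.2 m h1 h2 h3⟩, h1, h2, h3⟩
  chain a b c e h h' hbc := hd.chain a b c e h h' fun h => hbc (Subtype.ext h)

end IsTreeMetric

/-- The graph joining two points when no other point lies between them. -/
def segmentGraph (hd : IsTreeMetric d) : SimpleGraph W where
  Adj u v := u ≠ v ∧ ∀ w, Btw d u w v → w = u ∨ w = v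
  symm := ⟨fun _ _ h => ⟨h.1.symm, fun w hw => (h.2 w (hd.btw_symm hw)).symm⟩⟩
  loopless := ⟨fun _ h => h.1 rfl⟩

/-- The distance, seen as a function on unordered pairs. -/
def pairLength (hd : IsTreeMetric d) : Sym2 W → ℝ :=
  Sym2.lift ⟨d, hd.symm⟩

/-- The second vertex of a path of the segment graph lies between its ends: overlapping geodesics
are glued along the path. -/
theorem segmentGraph_path_snd_btw (hd : IsTreeMetric d) {u v w : W} (h : (segmentGraph hd).Adj u v)
    (p : (segmentGraph hd).Walk v w) (hp : (p.cons h).IsPath) : Btw d u v w := by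
  induction p generalizing u with
  | nil => exact hd.btw_right _ _
  | @cons v x w h' q ih =>
    rw [SimpleGraph.Walk.cons_isPath_iff] at hp
    have ih := ih h' hp.1
    obtain ⟨m, h1, h2, h3⟩ := hd.exists_median u v x
    have hux : u ≠ x := fun e => hp.2 (by simp [e])
    have hm : m = v := by
      rcases h.2 m h1 with e | e
      · rcases h'.2 m h2 with e' | e'
        · exact e'
        · exact absurd (e.symm.trans e') hux
      · exact e
    subst hm
    exact hd.chain_left h3 ih h'.1

/-- Paths of the segment graph are geodesics. -/
theorem segmentGraph_path_length (hd : IsTreeMetric d) {u v : W}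
    (p : (segmentGraph hd).Walk u v) (hp : p.IsPath) :
    d u v = (p.edges.map (pairLength hd)).sum := by
  induction p with
  | nil => simp [hd.self]
  | cons h q ih =>
    have := segmentGraph_path_snd_btw hd h q hp
    rw [SimpleGraph.Walk.cons_isPath_iff] at hp
    rw [SimpleGraph.Walk.edges_cons, List.map_cons, List.sum_cons, ← ih hp.1, ← this]
    rfl

theorem segmentGraph_isAcyclic (hd : IsTreeMetric d) : (segmentGraph hd).IsAcyclic := by
  intro u c hc
  cases c with
  | nil => exact hc.ne_nil rfl
  | @cons _ v _ h p =>
    rw [SimpleGraph.Walk.cons_isCycle_iff] at hc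
    obtain ⟨hp, he⟩ := hc
    cases p with
    | nil => exact h.1 rfl
    | @cons _ w _ h' q =>
      have hb := segmentGraph_path_snd_btw hd h' q hp
      rcases h.2 w (hd.btw_symm hb) with e | e
      · subst e
        exact he (by simp [Sym2.eq_swap])
      · exact h'.1 e.symm

theorem segmentGraph_reachable [Finite W] (hd : IsTreeMetric d) (u v : W) :
    (segmentGraph hd).Reachable u v := by
  induction hn : {w | Btw d u w v}.ncard using Nat.strong_induction_on generalizing u v with
  | _ n ih =>
    by_cases huv : u = v
    · rw [huv]
    by_cases hadj : (segmentGraph hd).Adj u v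
    · exact hadj.reachable
    have : ∃ w, Btw d u w v ∧ w ≠ u ∧ w ≠ v := by
      by_contra! hcon
      exact hadj ⟨huv, fun w hw => or_iff_not_imp_left.2 fun h => hcon w hw h⟩
    obtain ⟨w, hw, hwu, hwv⟩ := this
    refine (ih _ ?_ u w rfl).trans (ih _ ?_ w v rfl) <;> rw [← hn] <;>
      refine Set.ncard_lt_ncard ⟨fun x hx => ?_, fun hsub => ?_⟩ (Set.toFinite _)
    · exact hd.btw_trans_left hx hw
    · have h1 : Btw d u v w := hsub (hd.btw_right u v)
      exact hwv (hd.eq_of_btw_btw hw h1)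
    · exact hd.btw_symm (hd.btw_trans_left (hd.btw_symm hx) (hd.btw_symm hw))
    · have h1 : Btw d w u v := hsub (hd.btw_left u v)
      exact hwu (hd.eq_of_btw_btw (hd.btw_symm hw) (hd.btw_symm h1))

theorem segmentGraph_isTree [Finite W] [Nonempty W] (hd : IsTreeMetric d) :
    (segmentGraph hd).IsTree :=
  ⟨⟨segmentGraph_reachable hd⟩, segmentGraph_isAcyclic hd⟩

/-- The first vertex of the segment from `w` to another point. -/
theorem segmentGraph_exists_adj_btw [Finite W] (hd : IsTreeMetric d) {w x : W} (h : w ≠ x) :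
    ∃ n, (segmentGraph hd).Adj w n ∧ Btw d w n x := by
  obtain ⟨p, hp⟩ := (segmentGraph_reachable hd w x).exists_isPath
  cases p with
  | nil => exact absurd rfl h
  | cons h' q => exact ⟨_, h', segmentGraph_path_snd_btw hd h' q hp⟩

theorem segmentGraph_three_le_valency [Finite W] (hd : IsTreeMetric d) {w x y z : W}
    (hx : w ≠ x) (hy : w ≠ y) (hz : w ≠ z) (hxy : Btw d x w y) (hyz : Btw d y w z)
    (hxz : Btw d x w z) : 3 ≤ valency (segmentGraph hd) w := by
  obtain ⟨a, ha, hax⟩ := segmentGraph_exists_adj_btw hd hx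
  obtain ⟨b, hb, hby⟩ := segmentGraph_exists_adj_btw hd hy
  obtain ⟨c, hc, hcz⟩ := segmentGraph_exists_adj_btw hd hz
  have key : ∀ {s t k : W}, Btw d w k s → Btw d w k t → Btw d s w t → w = k := by
    intro s t k h1 h2 h3
    apply hd.eq_of_eq_zero
    unfold Btw at *
    linarith [hd.nonneg w k, hd.symm w k, hd.symm s w, hd.symm s k, hd.triangle s k t]
  have hab : a ≠ b := fun e => ha.1 (key hax (e ▸ hby) hxy)
  have hac : a ≠ c := fun e => ha.1 (key hax (e ▸ hcz) hxz)
  have hbc : b ≠ c := fun e => hb.1 (key hby (e ▸ hcz) hyz)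
  have : ({a, b, c} : Set W).ncard = 3 := Set.ncard_eq_three.2 ⟨a, b, c, hab, hac, hbc, rfl⟩
  rw [← this]
  refine Set.ncard_le_ncard ?_ (Set.toFinite _)
  rintro t (rfl | rfl | rfl)
  exacts [ha, hb, hc]

/-! ### Uniqueness of a tree metric spanned by medians -/

section Uniqueness

variable {X : Type uX} {W' : Type uW'} {d' : W' → W' → ℝ}

/-- Every point is a median of three marked points. -/
def MedianSpanned (d : W → W → ℝ) (ι : X → W) : Prop :=
  ∀ w, ∃ x y z, Btw d (ι x) w (ι y) ∧ Btw d (ι y) w (ι z) ∧ Btw d (ι x) w (ι z)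

/-- The distances from a median of three marked points to the marked points are determined by the
distances of the marked points. -/
theorem IsTreeMetric.dist_median_le (hd : IsTreeMetric d) (hd' : IsTreeMetric d') {ι : X → W}
    {ι' : X → W'} (hι : ∀ x y, d (ι x) (ι y) = d' (ι' x) (ι' y)) {x y z : X} {m : W} {m' : W'}
    (h1 : Btw d (ι x) m (ι y)) (h2 : Btw d (ι y) m (ι z)) (h3 : Btw d (ι x) m (ι z))
    (h1' : Btw d' (ι' x) m' (ι' y)) (h2' : Btw d' (ι' y) m' (ι' z))
    (h3' : Btw d' (ι' x) m' (ι' z)) (t : X) : d m (ι t) ≤ d' m' (ι' t) := by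
  have s1 := hd.symm m (ι t)
  have s2 := hd.symm m (ι x)
  have s3 := hd.symm m (ι y)
  have s1' := hd'.symm m' (ι' t)
  have s2' := hd'.symm m' (ι' x)
  have s3' := hd'.symm m' (ι' y)
  have e1 := hι x y
  have e2 := hι y z
  have e3 := hι x z
  have e4 := hι t x
  have e5 := hι t y
  have t1 := hd'.triangle (ι' t) m' (ι' x)
  have t2 := hd'.triangle (ι' t) m' (ι' y)
  rcases hd.btw_or_btw h1 (ι t) with h | h <;> unfold Btw at * <;> linarith

/-- A tree metric spanned by medians of marked points is determined by the distances of the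
marked points: any two such metrics are isometric, compatibly with the marks. -/
theorem IsTreeMetric.exists_isometry (hd : IsTreeMetric d) (hd' : IsTreeMetric d') {ι : X → W}
    {ι' : X → W'} (hι : ∀ x y, d (ι x) (ι y) = d' (ι' x) (ι' y)) (hs : MedianSpanned d ι)
    (hs' : MedianSpanned d' ι') :
    ∃ φ : W ≃ W', (∀ x, φ (ι x) = ι' x) ∧ ∀ u v, d' (φ u) (φ v) = d u v := by
  have hex : ∀ w, ∃ w', ∀ t, d' w' (ι' t) = d w (ι t) := by
    intro w
    obtain ⟨x, y, z, h1, h2, h3⟩ := hs w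
    obtain ⟨m, h1', h2', h3'⟩ := hd'.exists_median (ι' x) (ι' y) (ι' z)
    exact ⟨m, fun t => le_antisymm
      (hd'.dist_median_le hd (fun x y => (hι x y).symm) h1' h2' h3' h1 h2 h3 t)
      (hd.dist_median_le hd' hι h1 h2 h3 h1' h2' h3' t)⟩
  choose φ hφ using hex
  have hsurj' : ∀ w', ∃ w, ∀ t, d' w' (ι' t) = d w (ι t) := by
    intro w'
    obtain ⟨x, y, z, h1, h2, h3⟩ := hs' w'
    obtain ⟨m, h1', h2', h3'⟩ := hd.exists_median (ι x) (ι y) (ι z)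
    exact ⟨m, fun t => le_antisymm
      (hd'.dist_median_le hd (fun x y => (hι x y).symm) h1 h2 h3 h1' h2' h3' t)
      (hd.dist_median_le hd' hι h1' h2' h3' h1 h2 h3 t)⟩
  have hsep : ∀ u' v', (∀ t, d' u' (ι' t) = d' v' (ι' t)) → u' = v' := by
    intro u' v' h
    obtain ⟨x, y, z, h1, -, -⟩ := hs' v'
    apply hd'.eq_of_eq_zero
    rcases hd'.btw_or_btw h1 u' with h2 | h2 <;> unfold Btw at h2 <;> rw [h] at h2 <;> linarith
  have hiso : ∀ u v, d' (φ u) (φ v) = d u v := by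
    intro u v
    apply le_antisymm
    · obtain ⟨x, y, z, h1, -, -⟩ := hs' (φ v)
      rcases hd'.btw_or_btw h1 (φ u) with h2 | h2 <;> unfold Btw at h2 <;>
        rw [hφ, hφ] at h2 <;> linarith [hd.triangle u v (ι x), hd.triangle u v (ι y)]
    · obtain ⟨x, y, z, h1, -, -⟩ := hs v
      rcases hd.btw_or_btw h1 u with h2 | h2 <;> unfold Btw at h2 <;>
        rw [← hφ, ← hφ] at h2 <;>
        linarith [hd'.triangle (φ u) (φ v) (ι' x), hd'.triangle (φ u) (φ v) (ι' y)]
  have hbij : Function.Bijective φ := by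
    refine ⟨fun u v h => hd.eq_of_eq_zero _ _ ?_, fun w' => ?_⟩
    · rw [← hiso, h, hd'.self]
    · obtain ⟨w, hw⟩ := hsurj' w'
      exact ⟨w, hsep _ _ fun t => by rw [hφ, hw]⟩
  refine ⟨Equiv.ofBijective φ hbij, fun x => hsep _ _ fun t => ?_, hiso⟩
  rw [Equiv.ofBijective_apply, hφ, hι]

/-- An isometry is an isomorphism of segment graphs. -/
theorem segmentGraph_iso (hd : IsTreeMetric d) (hd' : IsTreeMetric d') (φ : W ≃ W')
    (hφ : ∀ u v, d' (φ u) (φ v) = d u v) :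
    ∃ ψ : segmentGraph hd ≃g segmentGraph hd', ∀ w, ψ w = φ w := by
  refine ⟨⟨φ, fun {u v} => and_congr (not_congr φ.injective.eq_iff) ?_⟩, fun _ => rfl⟩
  rw [φ.surjective.forall]
  simp only [Btw, hφ, φ.injective.eq_iff]

end Uniqueness

end TreeMetric

/-! ### The metric of a tree with edge lengths -/

section Walks

variable {W : Type uW} {T : SimpleGraph W}

theorem isPath_append_of_inter {u v w : W} {p : T.Walk u v} {q : T.Walk v w} (hp : p.IsPath)
    (hq : q.IsPath) (h : ∀ x ∈ p.support, x ∈ q.support → x = v) : (p.append q).IsPath := by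
  induction p with
  | nil => exact hq
  | cons e p ih =>
    rw [SimpleGraph.Walk.cons_isPath_iff] at hp
    rw [SimpleGraph.Walk.cons_append, SimpleGraph.Walk.cons_isPath_iff]
    refine ⟨ih hp.1 hq fun x hx hx' => h x (by simp [hx]) hx', fun hu => ?_⟩
    rw [SimpleGraph.Walk.mem_support_append_iff] at hu
    rcases hu with hu | hu
    · exact hp.2 hu
    · have := h _ (by simp) hu
      exact hp.2 (this ▸ p.end_mem_support)

theorem exists_path_to_set {A : Set W} {z x : W} (t : T.Walk z x) (hx : x ∈ A) :
    ∃ m ∈ A, ∃ r : T.Walk z m, r.IsPath ∧ ∀ w ∈ r.support, w ∈ A → w = m := by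
  classical
  induction t with
  | nil => exact ⟨_, hx, SimpleGraph.Walk.nil, SimpleGraph.Walk.IsPath.nil, by simp⟩
  | @cons z z' x h t ih =>
    by_cases hz : z ∈ A
    · exact ⟨z, hz, SimpleGraph.Walk.nil, SimpleGraph.Walk.IsPath.nil, by simp⟩
    · obtain ⟨m, hm, r, -, hr⟩ := ih hx
      refine ⟨m, hm, (r.cons h).bypass, SimpleGraph.Walk.bypass_isPath _, fun w hw hwA => ?_⟩
      have := SimpleGraph.Walk.support_bypass_subset_support _ hw
      rw [SimpleGraph.Walk.support_cons, List.mem_cons] at this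
      rcases this with rfl | h
      · exact absurd hwA hz
      · exact hr w h hwA

/-- Three vertices of a connected graph are joined by paths to a common vertex, so that the
paths from the third one meet those from the two others at this vertex only. -/
theorem exists_tripod (hT : T.Connected) (x y z : W) : ∃ m, ∃ p : T.Walk x m,
    ∃ q : T.Walk y m, ∃ r : T.Walk z m, (p.append q.reverse).IsPath ∧
      (q.append r.reverse).IsPath ∧ (p.append r.reverse).IsPath := by
  classical
  obtain ⟨s, hs⟩ := (hT.preconnected x y).exists_isPath
  obtain ⟨t⟩ := hT.preconnected z x
  obtain ⟨m, hm, r, hr, hrs⟩ := exists_path_to_set (A := {w | w ∈ s.support}) t s.start_mem_support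
  obtain ⟨p, q, rfl⟩ := SimpleGraph.Walk.mem_support_iff_exists_append.1 hm
  refine ⟨m, p, q.reverse, r, by simpa using hs,
    isPath_append_of_inter hs.of_append_right.reverse hr.reverse fun w h1 h2 => hrs w ?_ ?_,
    isPath_append_of_inter hs.of_append_left hr.reverse fun w h1 h2 => hrs w ?_ ?_⟩
  · simpa using h2
  · simp only [SimpleGraph.Walk.support_reverse, List.mem_reverse] at h1
    simp [SimpleGraph.Walk.mem_support_append_iff, h1]
  · simpa using h2
  · simp [SimpleGraph.Walk.mem_support_append_iff, h1]

end Walks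

section TreeDist

variable {W : Type uW} {T : SimpleGraph W}

/-- The length of the segment joining two vertices of a tree whose edges have lengths. -/
noncomputable def treeDist (hT : T.IsTree) (ℓ : Sym2 W → ℝ) (u v : W) : ℝ :=
  ((hT.existsUnique_path u v).choose.edges.map ℓ).sum

theorem treeDist_eq (hT : T.IsTree) (ℓ : Sym2 W → ℝ) {u v : W} {p : T.Walk u v} (hp : p.IsPath) :
    treeDist hT ℓ u v = (p.edges.map ℓ).sum := by
  rw [treeDist, ← (hT.existsUnique_path u v).choose_spec.2 p hp]

theorem treeDist_self (hT : T.IsTree) (ℓ : Sym2 W → ℝ) (u : W) : treeDist hT ℓ u u = 0 := by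
  simp [treeDist_eq hT ℓ (SimpleGraph.Walk.IsPath.nil (u := u))]

theorem treeDist_comm (hT : T.IsTree) (ℓ : Sym2 W → ℝ) (u v : W) :
    treeDist hT ℓ u v = treeDist hT ℓ v u := by
  obtain ⟨p, hp, -⟩ := hT.existsUnique_path u v
  rw [treeDist_eq hT ℓ hp, treeDist_eq hT ℓ hp.reverse]
  simp

theorem btw_of_isPath_append (hT : T.IsTree) (ℓ : Sym2 W → ℝ) {u v w : W} {p : T.Walk u v}
    {q : T.Walk v w} (h : (p.append q).IsPath) : Btw (treeDist hT ℓ) u v w := by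
  rw [Btw, treeDist_eq hT ℓ h, treeDist_eq hT ℓ h.of_append_left,
    treeDist_eq hT ℓ h.of_append_right]
  simp

theorem treeDist_pos (hT : T.IsTree) {ℓ : Sym2 W → ℝ} (hℓ : ∀ e ∈ T.edgeSet, 0 < ℓ e) {u v : W}
    (h : u ≠ v) : 0 < treeDist hT ℓ u v := by
  obtain ⟨p, hp, -⟩ := hT.existsUnique_path u v
  rw [treeDist_eq hT ℓ hp]
  apply List.sum_pos
  · intro x hx
    obtain ⟨e, he, rfl⟩ := List.mem_map.1 hx
    exact hℓ e (p.edges_subset_edgeSet he)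
  · cases p with
    | nil => exact absurd rfl h
    | cons _ _ => simp

theorem isPath_append_of_btw (hT : T.IsTree) {ℓ : Sym2 W → ℝ} (hℓ : ∀ e ∈ T.edgeSet, 0 < ℓ e)
    {u v w : W} (h : Btw (treeDist hT ℓ) u v w) :
    ∃ p : T.Walk u v, ∃ q : T.Walk v w, (p.append q).IsPath := by
  obtain ⟨m, p, q, r, h1, h2, h3⟩ := exists_tripod hT.1 u v w
  have hm : m = v := by
    by_contra hm
    have := treeDist_pos hT hℓ hm
    have b1 := btw_of_isPath_append hT ℓ h1
    have b2 := btw_of_isPath_append hT ℓ h2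
    have b3 := btw_of_isPath_append hT ℓ h3
    have s := treeDist_comm hT ℓ m v
    unfold Btw at *
    linarith
  subst hm
  exact ⟨p, r.reverse, h3⟩

/-- Betweenness for the metric of a tree is betweenness on its segments. -/
theorem btw_iff_mem_support (hT : T.IsTree) {ℓ : Sym2 W → ℝ} (hℓ : ∀ e ∈ T.edgeSet, 0 < ℓ e)
    {u v w : W} {p : T.Walk u w} (hp : p.IsPath) :
    Btw (treeDist hT ℓ) u v w ↔ v ∈ p.support := by
  classical
  constructor
  · intro h
    obtain ⟨p', q', h'⟩ := isPath_append_of_btw hT hℓ h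
    rw [(hT.existsUnique_path u w).unique hp h']
    simp [SimpleGraph.Walk.mem_support_append_iff]
  · intro h
    obtain ⟨p', q', rfl⟩ := SimpleGraph.Walk.mem_support_iff_exists_append.1 h
    exact btw_of_isPath_append hT ℓ hp

theorem treeDist_triangle (hT : T.IsTree) {ℓ : Sym2 W → ℝ} (hℓ : ∀ e ∈ T.edgeSet, 0 < ℓ e)
    (u v w : W) : treeDist hT ℓ u w ≤ treeDist hT ℓ u v + treeDist hT ℓ v w := by
  obtain ⟨m, p, q, r, h1, h2, h3⟩ := exists_tripod hT.1 u v w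
  have b1 := btw_of_isPath_append hT ℓ h1
  have b2 := btw_of_isPath_append hT ℓ h2
  have b3 := btw_of_isPath_append hT ℓ h3
  have s := treeDist_comm hT ℓ m v
  have : 0 ≤ treeDist hT ℓ m v := by
    rcases eq_or_ne m v with rfl | h
    · exact (treeDist_self hT ℓ m).ge
    · exact (treeDist_pos hT hℓ h).le
  unfold Btw at *
  linarith

theorem isTreeMetric_treeDist (hT : T.IsTree) {ℓ : Sym2 W → ℝ} (hℓ : ∀ e ∈ T.edgeSet, 0 < ℓ e) :
    IsTreeMetric (treeDist hT ℓ) where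
  self := treeDist_self hT ℓ
  symm := treeDist_comm hT ℓ
  triangle := treeDist_triangle hT hℓ
  eq_of_eq_zero x y h := by
    by_contra hxy
    exact (treeDist_pos hT hℓ hxy).ne' h
  exists_median x y z := by
    obtain ⟨m, p, q, r, h1, h2, h3⟩ := exists_tripod hT.1 x y z
    exact ⟨m, btw_of_isPath_append hT ℓ h1, btw_of_isPath_append hT ℓ h2,
      btw_of_isPath_append hT ℓ h3⟩
  chain a b c e habc hbce hbc := by
    -- It suffices to see that the median of `a`, `c`, `e` is `c`: both `b` and this median lie
    -- on the segment from `a` to `c`, in one order or the other.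
    obtain ⟨m, p, q, r, h1, h2, h3⟩ := exists_tripod hT.1 a c e
    have b1 := btw_of_isPath_append hT ℓ h1
    have b2 := btw_of_isPath_append hT ℓ h2
    have b3 := btw_of_isPath_append hT ℓ h3
    have s1 := treeDist_comm hT ℓ m c
    have s2 := treeDist_comm hT ℓ b m
    have s3 := treeDist_comm hT ℓ b c
    have hb := (btw_iff_mem_support hT hℓ h1).1 habc
    have tri := treeDist_triangle hT hℓ b m e
    have pos := treeDist_pos hT hℓ hbc
    rw [SimpleGraph.Walk.mem_support_append_iff] at hb
    rcases hb with hb | hb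
    · have b4 := (btw_iff_mem_support hT hℓ h1.of_append_left).2 hb
      have hm : m = c := by
        by_contra hm
        have := treeDist_pos hT hℓ hm
        unfold Btw at *
        linarith
      exact hm ▸ b3
    · have b4 := (btw_iff_mem_support hT hℓ h1.of_append_right).2 hb
      unfold Btw at *
      linarith

/-- A tree is the segment graph of its metric. -/
theorem segmentGraph_treeDist (hT : T.IsTree) {ℓ : Sym2 W → ℝ} (hℓ : ∀ e ∈ T.edgeSet, 0 < ℓ e) :
    segmentGraph (isTreeMetric_treeDist hT hℓ) = T := by
  ext u v
  constructor
  · rintro ⟨huv, h⟩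
    obtain ⟨p, hp, -⟩ := hT.existsUnique_path u v
    cases p with
    | nil => exact absurd rfl huv
    | @cons _ w _ e q =>
      rcases h w ((btw_iff_mem_support hT hℓ hp).2 (by simp)) with rfl | rfl
      · exact absurd rfl e.ne
      · exact e
  · intro h
    refine ⟨h.ne, fun w hw => ?_⟩
    have := (btw_iff_mem_support hT hℓ h.isPath_toWalk).1 hw
    simpa using this

theorem smoothing_eq_segmentGraph (hT : T.IsTree) {ℓ : Sym2 W → ℝ}
    (hℓ : ∀ e ∈ T.edgeSet, 0 < ℓ e) (S : Set W)
    (hd : IsTreeMetric fun a b : keptVertices T S => treeDist hT ℓ a b) :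
    smoothing T S = segmentGraph hd := by
  ext u v
  refine and_congr Iff.rfl ⟨?_, fun h => ?_⟩
  · rintro ⟨p, hp, h⟩ w hw
    have := h w ((btw_iff_mem_support hT hℓ hp).1 hw) w.2
    simpa [Subtype.ext_iff] using this
  · obtain ⟨p, hp, -⟩ := hT.existsUnique_path (u : W) v
    refine ⟨p, hp, fun w hw hwK => ?_⟩
    have := h ⟨w, hwK⟩ ((btw_iff_mem_support hT hℓ hp).2 hw)
    simpa [Subtype.ext_iff] using this

end TreeDist

/-! ### Tree hulls -/

section TreeHull

variable {W : Type uW} {T : SimpleGraph W} {X : Type uX} {ι : X → W} {ℓ : Sym2 W → ℝ}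

theorem exists_adj_adj_of_two_le_valency [Finite W] {w : W} (h : 2 ≤ valency T w) :
    ∃ a b, a ≠ b ∧ T.Adj w a ∧ T.Adj w b := by
  obtain ⟨a, ha, b, hb, hab⟩ := (Set.one_lt_ncard (Set.toFinite _)).1 (Nat.lt_of_succ_le h)
  exact ⟨a, b, hab, ha, hb⟩

/-- A segment can be continued up to a marked point if all the leaves are marked. -/
theorem exists_mark_btw [Finite W] (hT : T.IsTree) (hℓ : ∀ e ∈ T.edgeSet, 0 < ℓ e)
    (hleaf : ∀ w, w ∉ Set.range ι → 2 ≤ valency T w) (w n : W) :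
    ∃ x, Btw (treeDist hT ℓ) w n (ι x) := by
  have hd := isTreeMetric_treeDist hT hℓ
  obtain ⟨v, hv, hmax⟩ := Set.exists_max_image {v | Btw (treeDist hT ℓ) w n v} (treeDist hT ℓ w)
    (Set.toFinite _) ⟨n, hd.btw_right w n⟩
  by_cases hvX : v ∈ Set.range ι
  · obtain ⟨x, rfl⟩ := hvX
    exact ⟨x, hv⟩
  · -- Otherwise the segment from `w` to `v` can be continued by an edge at `v`.
    exfalso
    obtain ⟨a, b, hab, ha, hb⟩ := exists_adj_adj_of_two_le_valency (hleaf v hvX)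
    have hp : ((SimpleGraph.Walk.cons ha.symm SimpleGraph.Walk.nil).append
        (SimpleGraph.Walk.cons hb SimpleGraph.Walk.nil)).IsPath := by
      simp [SimpleGraph.Walk.cons_isPath_iff, hab, ha.ne', hb.ne]
    have key : ∀ y, T.Adj v y → ¬ Btw (treeDist hT ℓ) w v y := by
      intro y hy hby
      have h1 := hmax y (hd.btw_trans_left hv hby)
      have h2 := hd.pos hy.ne
      unfold Btw at hby
      linarith
    rcases hd.btw_or_btw (btw_of_isPath_append hT ℓ hp) w with h | h
    exacts [key a ha h, key b hb h]

theorem exists_median_marks [Finite W] (hT : T.IsTree) (hℓ : ∀ e ∈ T.edgeSet, 0 < ℓ e)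
    (hleaf : ∀ w, w ∉ Set.range ι → 2 ≤ valency T w) {w : W} (hw : 3 ≤ valency T w) :
    ∃ x y z, Btw (treeDist hT ℓ) (ι x) w (ι y) ∧ Btw (treeDist hT ℓ) (ι y) w (ι z) ∧
      Btw (treeDist hT ℓ) (ι x) w (ι z) := by
  have hd := isTreeMetric_treeDist hT hℓ
  obtain ⟨a, ha, b, hb, c, hc, hab, hac, hbc⟩ := (Set.two_lt_ncard (Set.toFinite _)).1
    (Nat.lt_of_succ_le hw)
  obtain ⟨x, hx⟩ := exists_mark_btw hT hℓ hleaf w a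
  obtain ⟨y, hy⟩ := exists_mark_btw hT hℓ hleaf w b
  obtain ⟨z, hz⟩ := exists_mark_btw hT hℓ hleaf w c
  have key : ∀ {s t k l : W}, T.Adj w s → T.Adj w t → s ≠ t → Btw (treeDist hT ℓ) w s k →
      Btw (treeDist hT ℓ) w t l → Btw (treeDist hT ℓ) k w l := by
    intro s t k l hs ht hst hk hl
    have hp : ((SimpleGraph.Walk.cons hs.symm SimpleGraph.Walk.nil).append
        (SimpleGraph.Walk.cons ht SimpleGraph.Walk.nil)).IsPath := by
      simp [SimpleGraph.Walk.cons_isPath_iff, hst, hs.ne', ht.ne]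
    have h1 : Btw (treeDist hT ℓ) s w l := hd.chain_left (btw_of_isPath_append hT ℓ hp) hl ht.ne
    exact hd.chain _ _ _ _ (hd.btw_symm hk) h1 hs.ne'
  exact ⟨x, y, z, key ha hb hab hx hy, key hb hc hbc hy hz, key ha hc hac hx hz⟩

theorem IsXTree.medianSpanned (h : IsXTree T ι) (hℓ : ∀ e ∈ T.edgeSet, 0 < ℓ e) :
    MedianSpanned (treeDist h.isTree ℓ) ι := by
  have := h.finite
  have hd := isTreeMetric_treeDist h.isTree hℓ
  intro w
  by_cases hw : w ∈ Set.range ι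
  · obtain ⟨x, rfl⟩ := hw
    exact ⟨x, x, x, hd.btw_left _ _, hd.btw_left _ _, hd.btw_left _ _⟩
  · have h3 : ∀ v, v ∉ Set.range ι → 3 ≤ valency T v := fun v hv =>
      Nat.succ_le_of_lt (not_le.1 fun h' => hv (h.mem_range v h'))
    exact exists_median_marks h.isTree hℓ (fun v hv => (Nat.le_succ 2).trans (h3 v hv)) (h3 w hw)

variable [MetricSpace X]

theorem treeDist_marks (hT : T.IsTree) (h : InducesDist T ι ℓ) (x y : X) :
    treeDist hT ℓ (ι x) (ι y) = dist x y := by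
  obtain ⟨p, hp, -⟩ := hT.existsUnique_path (ι x) (ι y)
  rw [treeDist_eq hT ℓ hp, h.2 x y p hp]

theorem IsTreeHull.fourPointsCondition (h : IsTreeHull X T ι) : FourPointsCondition X := by
  obtain ⟨hX, ℓ, hℓ⟩ := h
  intro a b c d
  simp only [← treeDist_marks hX.isTree hℓ]
  exact (isTreeMetric_treeDist hX.isTree hℓ.1).four_points _ _ _ _

/-- A finite metric space has at most one tree hull, up to isomorphism. -/
theorem IsTreeHull.xTreeIso {W' : Type uW'} {T' : SimpleGraph W'} {ι' : X → W'}
    (h : IsTreeHull X T ι) (h' : IsTreeHull X T' ι') : XTreeIso T ι T' ι' := by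
  obtain ⟨hX, ℓ, hℓ⟩ := h
  obtain ⟨hX', ℓ', hℓ'⟩ := h'
  obtain ⟨φ, hφ, hiso⟩ := (isTreeMetric_treeDist hX.isTree hℓ.1).exists_isometry
    (isTreeMetric_treeDist hX'.isTree hℓ'.1) (ι := ι) (ι' := ι')
    (fun x y => by rw [treeDist_marks hX.isTree hℓ, treeDist_marks hX'.isTree hℓ'])
    (hX.medianSpanned hℓ.1) (hX'.medianSpanned hℓ'.1)
  have hψ := segmentGraph_iso (isTreeMetric_treeDist hX.isTree hℓ.1)
    (isTreeMetric_treeDist hX'.isTree hℓ'.1) φ hiso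
  rw [segmentGraph_treeDist hX.isTree hℓ.1, segmentGraph_treeDist hX'.isTree hℓ'.1] at hψ
  obtain ⟨ψ, hψ⟩ := hψ
  exact ⟨ψ, fun x => (hψ _).trans (hφ x)⟩

/-- If all the leaves of a finite tree are marked, then the tree that remains when the unmarked
vertices of valency `2` are forgotten is a tree hull of the set of marks, for the
distance induced by any lengths of the edges. -/
theorem isTreeHull_smoothing [Finite W] (hT : T.IsTree) (hℓ : InducesDist T ι ℓ)
    (hι : Function.Injective ι) {S : Set W} (hS : S = Set.range ι)
    (hleaf : ∀ w, w ∉ Set.range ι → 2 ≤ valency T w) (κ : X → keptVertices T S)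
    (hκ : ∀ x, (κ x : W) = ι x) : IsTreeHull X (smoothing T S) κ := by
  have hd := isTreeMetric_treeDist hT hℓ.1
  have hdK : IsTreeMetric fun a b : keptVertices T S => treeDist hT ℓ a b := by
    refine hd.restrict _ fun x hx y hy z hz m h1 h2 h3 => ?_
    by_contra hm
    have hne : ∀ {t}, t ∈ keptVertices T S → m ≠ t := by
      rintro t ht rfl
      exact hm ht
    have h3 := segmentGraph_three_le_valency hd (hne hx) (hne hy) (hne hz) h1 h2 h3
    rw [segmentGraph_treeDist hT hℓ.1] at h3
    exact hm (Or.inr (by omega))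
  have hne : Nonempty (keptVertices T S) := by
    obtain ⟨w⟩ := hT.1.nonempty
    obtain ⟨x, -⟩ := exists_mark_btw hT hℓ.1 hleaf w w
    exact ⟨κ x⟩
  rw [smoothing_eq_segmentGraph hT hℓ.1 S hdK]
  refine ⟨⟨inferInstance, segmentGraph_isTree hdK, fun x y h => hι ?_, fun w hw => ?_⟩,
    pairLength hdK, ?_, fun x y p hp => ?_⟩
  · rw [← hκ, ← hκ, h]
  · by_contra hwX
    have hwS : (w : W) ∉ Set.range ι := by
      rintro ⟨x, hx⟩
      exact hwX ⟨x, Subtype.ext ((hκ x).trans hx)⟩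
    have h3 : 3 ≤ valency T (w : W) := by
      have h2 := hleaf w hwS
      rcases w.2 with h | h
      · exact absurd (hS ▸ h) hwS
      · omega
    obtain ⟨x, y, z, h1, h2, h3⟩ := exists_median_marks hT hℓ.1 hleaf h3
    rw [← hκ] at h1 h2 h3
    rw [← hκ] at h1 h2 h3
    have hne : ∀ t, w ≠ κ t := fun t ht => hwX ⟨t, ht.symm⟩
    have := segmentGraph_three_le_valency hdK (hne x) (hne y) (hne z) h1 h2 h3
    omega
  · intro e
    induction e with
    | h u v =>
      intro h
      exact hdK.pos ((SimpleGraph.mem_edgeSet _).1 h).ne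
  · rw [← segmentGraph_path_length hdK p hp, hκ, hκ, treeDist_marks hT hℓ]

end TreeHull

/-! ### Cells and inseparable subgraphs -/

section Cells

variable {α : Type uα} {β : Type uβ} {G H : Graph α β} {S S' : Set (α ⊕ β)}

theorem reachable_mem_of_closed {W : Type uW} {T : SimpleGraph W} {R : Set W}
    (h : ∀ x y, T.Adj x y → x ∈ R → y ∈ R) {x y : W} (hxy : T.Reachable x y) (hx : x ∈ R) :
    y ∈ R := by
  obtain ⟨p⟩ := hxy
  induction p with
  | nil => exact hx
  | cons e _ ih => exact ih (h _ _ e hx)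

theorem inl_mem_cells {v : α} : (Sum.inl v : α ⊕ β) ∈ cells G ↔ v ∈ V(G) := by
  simp [cells]

theorem inr_mem_cells {e : β} : (Sum.inr e : α ⊕ β) ∈ cells G ↔ e ∈ E(G) := by
  simp [cells]

theorem cells_mono (h : H ≤ G) : cells H ⊆ cells G := by
  rintro (v | e) hp
  · exact inl_mem_cells.2 (h.vertexSet_mono (inl_mem_cells.1 hp))
  · exact inr_mem_cells.2 (Graph.IsSubgraph.edgeSet_mono h (inr_mem_cells.1 hp))

theorem cellGraph_adj_of_inc {v : α} {e : β} (h : G.Inc e v) (hv : Sum.inl v ∈ S)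
    (he : Sum.inr e ∈ S) : (cellGraph G S).Adj (Sum.inl v) (Sum.inr e) :=
  (SimpleGraph.fromRel_adj _ _ _).2 ⟨by simp, Or.inl ⟨hv, he, v, e, rfl, rfl, h⟩⟩

theorem cellGraph_adj {p q : α ⊕ β} : (cellGraph G S).Adj p q ↔ p ∈ S ∧ q ∈ S ∧
    ∃ v e, G.Inc e v ∧ (p = Sum.inl v ∧ q = Sum.inr e ∨ p = Sum.inr e ∧ q = Sum.inl v) := by
  constructor
  · intro h
    rcases ((SimpleGraph.fromRel_adj _ _ _).1 h).2 with ⟨hp, hq, v, e, h1, h2, h3⟩ |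
      ⟨hq, hp, v, e, h1, h2, h3⟩
    · exact ⟨hp, hq, v, e, h3, Or.inl ⟨h1, h2⟩⟩
    · exact ⟨hp, hq, v, e, h3, Or.inr ⟨h2, h1⟩⟩
  · rintro ⟨hp, hq, v, e, h, ⟨rfl, rfl⟩ | ⟨rfl, rfl⟩⟩
    · exact cellGraph_adj_of_inc h hp hq
    · exact (cellGraph_adj_of_inc h hq hp).symm

theorem cellGraph_mono (h : S ⊆ S') : cellGraph G S ≤ cellGraph G S' := fun _ _ hpq => by
  rw [cellGraph_adj] at *
  exact ⟨h hpq.1, h hpq.2.1, hpq.2.2⟩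

theorem cellGraph_eq_of_le (hH : H ≤ G) (hS : S ⊆ cells H) : cellGraph H S = cellGraph G S := by
  ext p q
  rw [cellGraph_adj, cellGraph_adj]
  refine and_congr_right fun hp => and_congr_right fun hq => exists_congr fun v =>
    exists_congr fun e => and_congr_left fun h => Graph.IsSubgraph.inc_congr hH ?_
  rcases h with ⟨-, rfl⟩ | ⟨rfl, -⟩
  exacts [inr_mem_cells.1 (hS hq), inr_mem_cells.1 (hS hp)]

theorem support_subset_of_cellGraph {p q : α ⊕ β} (w : (cellGraph G S).Walk p q) (hp : p ∈ S) :
    ∀ r ∈ w.support, r ∈ S := by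
  induction w with
  | nil => simpa using hp
  | cons h w ih =>
    intro r hr
    rw [SimpleGraph.Walk.support_cons, List.mem_cons] at hr
    rcases hr with rfl | hr
    · exact hp
    · exact ih (cellGraph_adj.1 h).2.1 r hr

theorem reachable_of_support_subset {p q : α ⊕ β} (w : (cellGraph G S).Walk p q)
    (hw : ∀ r ∈ w.support, r ∈ S') : (cellGraph G S').Reachable p q := by
  induction w with
  | nil => rfl
  | cons h w ih =>
    refine SimpleGraph.Reachable.trans (SimpleGraph.Adj.reachable (cellGraph_adj.2
      ⟨hw _ (by simp), hw _ (by simp), (cellGraph_adj.1 h).2.2⟩)) (ih fun r hr => hw r ?_)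
    simp [hr]

theorem preconnectedOn_of_forall_reachable {b : α ⊕ β}
    (h : ∀ p ∈ S, (cellGraph G S).Reachable p b) : PreconnectedOn G S :=
  fun p hp q hq => (h p hp).trans (h q hq).symm

/-- A subgraph is inseparable if it stays connected after the removal of at most one vertex. -/
theorem inseparable_iff (hH : H ≤ G) : Inseparable H ↔ V(H).Nonempty ∧
    ∀ (x : α) (D : Set (α ⊕ β)), D ⊆ {Sum.inl x} → PreconnectedOn G (cells H \ D) := by
  have key : ∀ D : Set (α ⊕ β), PreconnectedOn H (cells H \ D) ↔ PreconnectedOn G (cells H \ D) :=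
    fun D => by rw [PreconnectedOn, cellGraph_eq_of_le hH Set.sdiff_subset, PreconnectedOn]
  have key0 := key ∅
  rw [Set.sdiff_empty] at key0
  constructor
  · rintro ⟨⟨hne, hc⟩, hv⟩
    refine ⟨hne, fun x D hD => ?_⟩
    rcases Set.subset_singleton_iff_eq.1 hD with rfl | rfl
    · rw [Set.sdiff_empty, ← key0]
      exact hc
    · by_cases hx : x ∈ V(H)
      · rw [← key]
        by_contra h
        exact hv x ⟨hx, h⟩
      · rw [Set.sdiff_singleton_eq_self (mt inl_mem_cells.1 hx), ← key0]
        exact hc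
  · rintro ⟨hne, h⟩
    refine ⟨⟨hne, ?_⟩, fun v hv => hv.2 ((key _).2 (h v _ subset_rfl))⟩
    obtain ⟨x, -⟩ := hne
    have := h x ∅ (Set.empty_subset _)
    rwa [Set.sdiff_empty, ← key0] at this

theorem inseparable_banana {e : β} {u v : α} : Inseparable (Graph.banana u v {e}) := by
  refine (inseparable_iff le_rfl).2 ⟨⟨u, by simp⟩, fun x D hD =>
    preconnectedOn_of_forall_reachable (b := Sum.inr e) ?_⟩
  have he : Sum.inr e ∈ cells (Graph.banana u v {e}) \ D :=
    ⟨inr_mem_cells.2 (by simp), fun h => by simpa using hD h⟩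
  rintro (w | f) hp
  · refine (cellGraph_adj_of_inc ?_ hp he).reachable
    have := inl_mem_cells.1 hp.1
    simpa [Graph.banana_inc] using this
  · have := inr_mem_cells.1 hp.1
    rw [show f = e by simpa using this]

theorem banana_le {e : β} {u v : α} (h : G.IsLink e u v) : Graph.banana u v {e} ≤ G := by
  refine ⟨?_, fun f x y hf => ?_⟩
  · rintro w hw
    rcases (by simpa using hw : w = u ∨ w = v) with rfl | rfl
    exacts [h.left_mem, h.right_mem]
  · have : f = e ∧ s(x, y) = s(u, v) := by simpa [Graph.banana] using hf
    rw [this.1, h.isLink_iff_sym2_eq]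
    exact this.2.symm

/-- The smallest subgraph of `G` that contains the cells of `S` belonging to `G`. -/
def cellClosure (G : Graph α β) (S : Set (α ⊕ β)) : Graph α β :=
  (G.induce {v | v ∈ V(G) ∧ (Sum.inl v ∈ S ∨ ∃ e, Sum.inr e ∈ S ∧ G.Inc e v)}).restrict
    {e | Sum.inr e ∈ S}

theorem cellClosure_le : cellClosure G S ≤ G :=
  Graph.restrict_le.trans (Graph.induce_le fun _ h => h.1)

theorem mem_vertexSet_cellClosure {v : α} : v ∈ V(cellClosure G S) ↔
    v ∈ V(G) ∧ (Sum.inl v ∈ S ∨ ∃ e, Sum.inr e ∈ S ∧ G.Inc e v) := by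
  rfl

theorem mem_edgeSet_cellClosure {e : β} :
    e ∈ E(cellClosure G S) ↔ e ∈ E(G) ∧ Sum.inr e ∈ S := by
  constructor
  · intro h
    refine ⟨Graph.IsSubgraph.edgeSet_mono cellClosure_le h, ?_⟩
    simpa using (show e ∈ _ ∩ _ from h).2
  · rintro ⟨h, hS⟩
    obtain ⟨x, y, hxy⟩ := Graph.exists_isLink_of_mem_edgeSet h
    refine Graph.IsLink.edge_mem (x := x) (y := y) ?_
    have hx := hxy.left_mem
    have hy := hxy.right_mem
    simp only [cellClosure, Graph.restrict_isLink, Graph.induce_isLink]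
    exact ⟨hS, hxy, ⟨hx, Or.inr ⟨e, hS, hxy.inc_left⟩⟩, ⟨hy, Or.inr ⟨e, hS, hxy.inc_right⟩⟩⟩

theorem subset_cells_cellClosure (hS : S ⊆ cells G) : S ⊆ cells (cellClosure G S) := by
  rintro (v | e) h
  · exact inl_mem_cells.2 (mem_vertexSet_cellClosure.2 ⟨inl_mem_cells.1 (hS h), Or.inl h⟩)
  · exact inr_mem_cells.2 (mem_edgeSet_cellClosure.2 ⟨inr_mem_cells.1 (hS h), h⟩)

theorem le_of_cells_subset {K : Graph α β} (hH : H ≤ G) (hK : K ≤ G) (h : cells H ⊆ cells K) :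
    H ≤ K :=
  (Graph.Compatible.of_le_le hH hK).le_iff.2
    ⟨fun _ hv => inl_mem_cells.1 (h (inl_mem_cells.2 hv)),
      fun _ he => inr_mem_cells.1 (h (inr_mem_cells.2 he))⟩

/-- Two inseparable subgraphs that share a vertex `b` and are joined by a path avoiding `b` are
contained in one inseparable subgraph: their union with this path. -/
theorem exists_inseparable_ge {H₁ H₂ : Graph α β} (h₁ : H₁ ≤ G) (h₂ : H₂ ≤ G)
    (hi₁ : Inseparable H₁) (hi₂ : Inseparable H₂) {b : α} (hb₁ : b ∈ V(H₁)) (hb₂ : b ∈ V(H₂))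
    {p₁ p₂ : α ⊕ β} (hp₁ : p₁ ∈ cells H₁ \ {Sum.inl b}) (hp₂ : p₂ ∈ cells H₂ \ {Sum.inl b})
    (hp : (cellGraph G (cells G \ {Sum.inl b})).Reachable p₁ p₂) :
    ∃ U ≤ G, Inseparable U ∧ H₁ ≤ U ∧ H₂ ≤ U := by
  classical
  obtain ⟨P, hP⟩ := hp.exists_isPath
  have hPs := support_subset_of_cellGraph P ⟨cells_mono h₁ hp₁.1, hp₁.2⟩
  set S : Set (α ⊕ β) := cells H₁ ∪ cells H₂ ∪ {r | r ∈ P.support} with hS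
  have hSG : S ⊆ cells G := Set.union_subset (Set.union_subset (cells_mono h₁) (cells_mono h₂))
    fun r hr => (hPs r hr).1
  have hSU := subset_cells_cellClosure hSG
  have hH₁ : cells H₁ ⊆ cells (cellClosure G S) := fun r hr => hSU (Or.inl (Or.inl hr))
  have hH₂ : cells H₂ ⊆ cells (cellClosure G S) := fun r hr => hSU (Or.inl (Or.inr hr))
  have hPU : ∀ r ∈ P.support, r ∈ cells (cellClosure G S) := fun r hr => hSU (Or.inr hr)
  refine ⟨cellClosure G S, cellClosure_le, (inseparable_iff cellClosure_le).2
    ⟨⟨b, inl_mem_cells.1 (hH₁ (inl_mem_cells.2 hb₁))⟩, fun x D hD => ?_⟩,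
    le_of_cells_subset h₁ cellClosure_le hH₁, le_of_cells_subset h₂ cellClosure_le hH₂⟩
  have hc₁ := ((inseparable_iff h₁).1 hi₁).2 x D hD
  have hc₂ := ((inseparable_iff h₂).1 hi₂).2 x D hD
  -- Each cell of the path is joined to one end of the path in the complement of `D`.
  have hPr : ∀ q ∈ P.support, q ∉ D →
      (p₁ ∉ D ∧ (cellGraph G (cells (cellClosure G S) \ D)).Reachable q p₁) ∨
      (p₂ ∉ D ∧ (cellGraph G (cells (cellClosure G S) \ D)).Reachable q p₂) := by
    intro q hq hqD
    obtain ⟨P₁, P₂, rfl⟩ := SimpleGraph.Walk.mem_support_iff_exists_append.1 hq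
    by_cases hx : ∃ r ∈ P₁.support, r ∈ D
    · obtain ⟨r, hr, hrD⟩ := hx
      have hP₂ : ∀ s ∈ P₂.support, s ∉ D := by
        intro s hs hsD
        obtain rfl : s = r := (hD hsD).trans (hD hrD).symm
        exact hP.ne_of_mem_support_of_append (fun h => hqD (h ▸ hsD)) hr hs rfl
      exact Or.inr ⟨hP₂ _ P₂.end_mem_support, reachable_of_support_subset
        (S' := cells (cellClosure G S) \ D) P₂ fun s hs =>
        ⟨hPU s (by simp [SimpleGraph.Walk.mem_support_append_iff, hs]), hP₂ s hs⟩⟩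
    · push Not at hx
      exact Or.inl ⟨hx _ P₁.start_mem_support, (reachable_of_support_subset
        (S' := cells (cellClosure G S) \ D) P₁ fun s hs =>
        ⟨hPU s (by simp [SimpleGraph.Walk.mem_support_append_iff, hs]), hx s hs⟩).symm⟩
  have m₁ : ∀ {r s}, r ∈ cells H₁ \ D → s ∈ cells H₁ \ D →
      (cellGraph G (cells (cellClosure G S) \ D)).Reachable r s := fun hr hs =>
    (hc₁ _ hr _ hs).mono (cellGraph_mono (Set.sdiff_subset_sdiff_left hH₁))
  have m₂ : ∀ {r s}, r ∈ cells H₂ \ D → s ∈ cells H₂ \ D →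
      (cellGraph G (cells (cellClosure G S) \ D)).Reachable r s := fun hr hs =>
    (hc₂ _ hr _ hs).mono (cellGraph_mono (Set.sdiff_subset_sdiff_left hH₂))
  obtain ⟨c, hcH₁, hcH₂⟩ : ∃ c, (∀ r ∈ cells H₁ \ D,
      (cellGraph G (cells (cellClosure G S) \ D)).Reachable r c) ∧ (∀ r ∈ cells H₂ \ D,
      (cellGraph G (cells (cellClosure G S) \ D)).Reachable r c) := by
    by_cases hbD : Sum.inl b ∈ D
    · obtain rfl : b = x := by simpa using hD hbD
      have hD₁ : p₁ ∉ D := fun h => hp₁.2 (hD h)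
      have hD₂ : p₂ ∉ D := fun h => hp₂.2 (hD h)
      have hr : (cellGraph G (cells (cellClosure G S) \ D)).Reachable p₂ p₁ :=
        (reachable_of_support_subset (S' := cells (cellClosure G S) \ D) P fun s hs =>
          ⟨hPU s hs, fun h => (hPs s hs).2 (hD h)⟩).symm
      exact ⟨p₁, fun r hr => m₁ hr ⟨hp₁.1, hD₁⟩, fun r hr' => (m₂ hr' ⟨hp₂.1, hD₂⟩).trans hr⟩
    · exact ⟨Sum.inl b, fun r hr => m₁ hr ⟨inl_mem_cells.2 hb₁, hbD⟩,
        fun r hr => m₂ hr ⟨inl_mem_cells.2 hb₂, hbD⟩⟩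
  have hcS : ∀ r ∈ S, r ∉ D → (cellGraph G (cells (cellClosure G S) \ D)).Reachable r c := by
    rintro r ((hr | hr) | hr) hrD
    · exact hcH₁ r ⟨hr, hrD⟩
    · exact hcH₂ r ⟨hr, hrD⟩
    · rcases hPr r hr hrD with ⟨h, h'⟩ | ⟨h, h'⟩
      · exact h'.trans (hcH₁ _ ⟨hp₁.1, h⟩)
      · exact h'.trans (hcH₂ _ ⟨hp₂.1, h⟩)
  refine preconnectedOn_of_forall_reachable (b := c) ?_
  rintro (v | e) hr
  · rcases (mem_vertexSet_cellClosure.1 (inl_mem_cells.1 hr.1)).2 with h | ⟨e, he, hev⟩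
    · exact hcS _ h hr.2
    · have heD : Sum.inr e ∉ D := fun h => by simpa using hD h
      exact (cellGraph_adj_of_inc hev hr ⟨hSU he, heD⟩).reachable.trans (hcS _ he heD)
  · exact hcS _ (mem_edgeSet_cellClosure.1 (inr_mem_cells.1 hr.1)).2 hr.2

/-- A bridge is the only edge of any inseparable subgraph that contains it. -/
theorem IsBridge.eq_of_inseparable {K : Graph α β} (hG : PreconnectedOn G (cells G)) {e f : β}
    (he : IsBridge G e) (hK : K ≤ G) (hi : Inseparable K) (heK : e ∈ E(K)) (hf : f ∈ E(K)) :
    f = e := by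
  by_contra hfe
  obtain ⟨u, v, huv⟩ := Graph.exists_isLink_of_mem_edgeSet he.1
  have hfG : Sum.inr f ∈ cells G \ {Sum.inr e} :=
    ⟨cells_mono hK (inr_mem_cells.2 hf), by simpa using hfe⟩
  -- Both ends of `e` are joined to `f` in the complement of `e`: without the other end, `K` still
  -- joins `e` to `f`.
  have key : ∀ {x y : α}, G.IsLink e x y →
      (cellGraph G (cells G \ {Sum.inr e})).Reachable (Sum.inr f) (Sum.inl y) := by
    intro x y hxy
    by_contra hy
    have hc := ((inseparable_iff hK).1 hi).2 x {Sum.inl x} subset_rfl (Sum.inr f)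
      ⟨inr_mem_cells.2 hf, by simp⟩ (Sum.inr e) ⟨inr_mem_cells.2 heK, by simp⟩
    have := reachable_mem_of_closed
      (R := {q | q ≠ Sum.inr e ∧ (cellGraph G (cells G \ {Sum.inr e})).Reachable (Sum.inr f) q})
      ?_ hc ⟨hfG.2, SimpleGraph.Reachable.refl _⟩
    · exact this.1 rfl
    · rintro q r hqr ⟨hqe, hq⟩
      obtain ⟨hqK, hrK, w, g, hwg, h⟩ := cellGraph_adj.1 hqr
      have hre : r ≠ Sum.inr e := by
        rintro rfl
        rcases h with ⟨rfl, h⟩ | ⟨-, h⟩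
        · obtain rfl := Sum.inr_injective h
          rcases hwg.eq_or_eq_of_isLink hxy with rfl | rfl
          · exact hqK.2 rfl
          · exact hy hq
        · cases h
      exact ⟨hre, hq.trans (SimpleGraph.Adj.reachable (cellGraph_adj.2
        ⟨⟨cells_mono hK hqK.1, hqe⟩, ⟨cells_mono hK hrK.1, hre⟩, w, g, hwg, h⟩))⟩
  refine he.2 (preconnectedOn_of_forall_reachable (b := Sum.inr f) fun p hp => ?_)
  have := reachable_mem_of_closed (R := {q | q = Sum.inr e ∨
      (cellGraph G (cells G \ {Sum.inr e})).Reachable (Sum.inr f) q}) ?_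
      (hG (Sum.inr f) hfG.1 p hp.1) (Or.inr (SimpleGraph.Reachable.refl _))
  · exact (this.resolve_left hp.2).symm
  · intro q r hqr hq
    obtain ⟨hqG, hrG, w, g, hwg, h⟩ := cellGraph_adj.1 hqr
    by_cases hre : r = Sum.inr e
    · exact Or.inl hre
    · refine Or.inr ?_
      by_cases hqe : q = Sum.inr e
      · rcases h with ⟨h, -⟩ | ⟨h, rfl⟩
        · rw [hqe] at h
          cases h
        · obtain rfl := Sum.inr_injective (hqe.symm.trans h)
          rcases hwg.eq_or_eq_of_isLink huv with rfl | rfl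
          exacts [key huv.symm, key huv]
      · exact (hq.resolve_left hqe).trans (SimpleGraph.Adj.reachable (cellGraph_adj.2
          ⟨⟨hqG, hqe⟩, ⟨hrG, hre⟩, w, g, hwg, h⟩))

theorem finite_setOf_le (hV : V(G).Finite) (hE : E(G).Finite) : {K : Graph α β | K ≤ G}.Finite := by
  refine Set.Finite.of_injOn (f := fun K : Graph α β => (V(K), E(K))) (t := 𝒫 V(G) ×ˢ 𝒫 E(G))
    ?_ ?_ (hV.finite_subsets.prod hE.finite_subsets)
  · intro K hK
    exact ⟨hK.vertexSet_mono, Graph.IsSubgraph.edgeSet_mono hK⟩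
  · intro K hK L hL h
    exact Graph.Compatible.ext (congrArg Prod.fst h) (congrArg Prod.snd h)
      (Graph.Compatible.of_le_le hK hL)

theorem exists_isBrick (hV : V(G).Finite) (hE : E(G).Finite) {e : β} (he : e ∈ E(G))
    (hb : ¬ IsBridge G e) : ∃ H, IsBrick G H ∧ e ∈ E(H) := by
  obtain ⟨u, v, huv⟩ := Graph.exists_isLink_of_mem_edgeSet he
  obtain ⟨H, hle, hH⟩ := ((finite_setOf_le hV hE).subset
    (t := {K : Graph α β | K ≤ G ∧ Inseparable K}) fun _ h => h.1).exists_le_maximal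
    ⟨banana_le huv, inseparable_banana⟩
  have heH : e ∈ E(H) := Graph.IsSubgraph.edgeSet_mono hle (by simp)
  refine ⟨H, ⟨hH, ⟨e, heH⟩, ?_⟩, heH⟩
  rintro ⟨f, hf, hHf⟩
  obtain rfl : e = f := by simpa [hHf] using heH
  exact hb hf

end Cells

/-! ### The brick-vertex tree -/

section BrickVertexTree

variable {α : Type uα} {β : Type uβ} {G : Graph α β}

theorem bvTree_adj_inl_inl {u v : V(G)} : (bvTree G).Adj (Sum.inl u) (Sum.inl v) ↔
    u ≠ v ∧ ∃ e, IsBridge G e ∧ G.IsLink e u v := by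
  rw [bvTree, SimpleGraph.fromRel_adj]
  simp only [ne_eq, Sum.inl.injEq, Graph.isLink_comm (x := (v : α)), or_self]

theorem bvTree_adj_inl_inr {u : V(G)} {b : {H : Graph α β // IsBrick G H}} :
    (bvTree G).Adj (Sum.inl u) (Sum.inr b) ↔ (u : α) ∈ V(b.1) := by
  rw [bvTree, SimpleGraph.fromRel_adj]
  simp

theorem bvTree_not_adj_inr_inr {b c : {H : Graph α β // IsBrick G H}} :
    ¬ (bvTree G).Adj (Sum.inr b) (Sum.inr c) := by
  rw [bvTree, SimpleGraph.fromRel_adj]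
  simp

theorem exists_eq_inl_of_adj_inr {b : {H : Graph α β // IsBrick G H}} {p : BVVertex G}
    (h : (bvTree G).Adj (Sum.inr b) p) : ∃ u : V(G), p = Sum.inl u ∧ (u : α) ∈ V(b.1) := by
  rcases p with u | c
  · exact ⟨u, rfl, bvTree_adj_inl_inr.1 h.symm⟩
  · exact absurd h bvTree_not_adj_inr_inr

theorem finite_bvVertex (hV : V(G).Finite) (hE : E(G).Finite) : Finite (BVVertex G) := by
  have h1 : Finite V(G) := hV
  have h2 : Finite {H : Graph α β // IsBrick G H} :=
    ((finite_setOf_le hV hE).subset fun H hH => hH.1.1.1 : {H : Graph α β | IsBrick G H}.Finite)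
  infer_instance

/-- A cell of `G` representing a vertex of the brick-vertex tree: the vertex itself, or an edge of
the brick. -/
noncomputable def cellOf : BVVertex G → α ⊕ β
  | Sum.inl v => Sum.inl v
  | Sum.inr b => Sum.inr b.2.2.1.some

theorem cellOf_mem_brick (b : {H : Graph α β // IsBrick G H}) :
    cellOf (Sum.inr b) ∈ cells b.1 :=
  inr_mem_cells.2 b.2.2.1.some_mem

theorem cellOf_ne {b : V(G)} {p : BVVertex G} (hp : p ≠ Sum.inl b) :
    cellOf p ≠ Sum.inl (b : α) := by
  rcases p with u | c
  · intro h
    exact hp (congrArg _ (Subtype.ext (Sum.inl_injective h)))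
  · simp [cellOf]

theorem IsBrick.le {H : Graph α β} (h : IsBrick G H) : H ≤ G := h.1.1.1

theorem IsBrick.preconnectedOn {H : Graph α β} (h : IsBrick G H) (x : α) :
    PreconnectedOn G (cells H \ {Sum.inl x}) :=
  ((inseparable_iff h.le).1 h.1.1.2).2 x _ subset_rfl

theorem reachable_of_mem_brick {H : Graph α β} (h : IsBrick G H) {x : α} {p q : α ⊕ β}
    (hp : p ∈ cells H) (hq : q ∈ cells H) (hpx : p ≠ Sum.inl x) (hqx : q ≠ Sum.inl x) :
    (cellGraph G (cells G \ {Sum.inl x})).Reachable p q :=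
  (h.preconnectedOn x p ⟨hp, hpx⟩ q ⟨hq, hqx⟩).mono
    (cellGraph_mono (Set.sdiff_subset_sdiff_left (cells_mono h.le)))

theorem reachable_cellOf_of_adj {b : V(G)} {p q : BVVertex G} (h : (bvTree G).Adj p q)
    (hp : p ≠ Sum.inl b) (hq : q ≠ Sum.inl b) :
    (cellGraph G (cells G \ {Sum.inl (b : α)})).Reachable (cellOf p) (cellOf q) := by
  have hp' := cellOf_ne hp
  have hq' := cellOf_ne hq
  rcases p with u | c <;> rcases q with v | d
  · obtain ⟨-, e, he, huv⟩ := bvTree_adj_inl_inl.1 h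
    have heG : Sum.inr e ∈ cells G \ {Sum.inl (b : α)} := ⟨inr_mem_cells.2 he.1, by simp⟩
    have huG : Sum.inl (u : α) ∈ cells G \ {Sum.inl (b : α)} := ⟨inl_mem_cells.2 u.2, hp'⟩
    have hvG : Sum.inl (v : α) ∈ cells G \ {Sum.inl (b : α)} := ⟨inl_mem_cells.2 v.2, hq'⟩
    exact (cellGraph_adj_of_inc huv.inc_left huG heG).reachable.trans
      (cellGraph_adj_of_inc huv.inc_right hvG heG).reachable.symm
  · exact reachable_of_mem_brick d.2 (inl_mem_cells.2 (bvTree_adj_inl_inr.1 h))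
      (cellOf_mem_brick d) hp' hq'
  · exact reachable_of_mem_brick c.2 (cellOf_mem_brick c)
      (inl_mem_cells.2 (bvTree_adj_inl_inr.1 h.symm)) hp' hq'
  · exact absurd h bvTree_not_adj_inr_inr

/-- A walk of the brick-vertex tree that avoids a vertex `b` of `G` stays in one connected
component of the complement of `b`. -/
theorem reachable_cellOf_of_walk {b : V(G)} {p q : BVVertex G} (w : (bvTree G).Walk p q)
    (hw : Sum.inl b ∉ w.support) :
    (cellGraph G (cells G \ {Sum.inl (b : α)})).Reachable (cellOf p) (cellOf q) := by
  induction w with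
  | nil => rfl
  | @cons p r q h w ih =>
    rw [SimpleGraph.Walk.support_cons, List.mem_cons, not_or] at hw
    refine (reachable_cellOf_of_adj h (Ne.symm hw.1) ?_).trans (ih hw.2)
    rintro rfl
    exact hw.2 w.start_mem_support

theorem exists_inseparable_of_adj {b : V(G)} {p : BVVertex G}
    (h : (bvTree G).Adj (Sum.inl b) p) : ∃ H ≤ G, Inseparable H ∧ (b : α) ∈ V(H) ∧
      cellOf p ∈ cells H \ {Sum.inl (b : α)} ∧ ((∃ c, p = Sum.inr c ∧ c.1 = H) ∨
        ∃ e, ∃ u : V(G), p = Sum.inl u ∧ IsBridge G e ∧ G.IsLink e b u ∧ e ∈ E(H)) := by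
  rcases p with u | c
  · obtain ⟨hbu, e, he, hl⟩ := bvTree_adj_inl_inl.1 h
    refine ⟨Graph.banana b u {e}, banana_le hl, inseparable_banana, by simp, ⟨?_, ?_⟩,
      Or.inr ⟨e, u, rfl, he, hl, by simp⟩⟩
    · exact inl_mem_cells.2 (by simp)
    · exact cellOf_ne (by simpa using hbu.symm)
  · exact ⟨c.1, c.2.le, c.2.1.1.2, bvTree_adj_inl_inr.1 h,
      ⟨cellOf_mem_brick c, cellOf_ne (by simp)⟩, Or.inl ⟨c, rfl, rfl⟩⟩

/-- Different neighbors of a vertex `b` of `G` in the brick-vertex tree lie in different connected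
components of the complement of `b`. -/
theorem eq_of_adj_of_reachable (hG : PreconnectedOn G (cells G)) {b : V(G)} {p q : BVVertex G}
    (hp : (bvTree G).Adj (Sum.inl b) p) (hq : (bvTree G).Adj (Sum.inl b) q)
    (h : (cellGraph G (cells G \ {Sum.inl (b : α)})).Reachable (cellOf p) (cellOf q)) :
    p = q := by
  obtain ⟨H, hH, hHi, hbH, hpH, hp'⟩ := exists_inseparable_of_adj hp
  obtain ⟨K, hK, hKi, hbK, hqK, hq'⟩ := exists_inseparable_of_adj hq
  obtain ⟨U, hU, hUi, hHU, hKU⟩ := exists_inseparable_ge hH hK hHi hKi hbH hbK hpH hqK h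
  -- A brick has an edge, and would be a bridge if it lay in the same inseparable graph as a bridge.
  have key : ∀ (c : {H : Graph α β // IsBrick G H}) (e : β), IsBridge G e → e ∈ E(U) →
      ¬ c.1 ≤ U := by
    intro c e he heU hc
    obtain ⟨f, hf⟩ := c.2.2.1
    have huniq : ∀ g ∈ E(c.1), g = e := fun g hg =>
      he.eq_of_inseparable hG hU hUi heU (Graph.IsSubgraph.edgeSet_mono hc hg)
    exact c.2.2.2 ⟨e, he, Set.eq_singleton_iff_unique_mem.2 ⟨huniq f hf ▸ hf, huniq⟩⟩
  rcases hp' with ⟨c, rfl, rfl⟩ | ⟨e, u, rfl, he, hbu, heH⟩ <;>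
    rcases hq' with ⟨d, rfl, rfl⟩ | ⟨f, v, rfl, hf, hbv, hfK⟩
  · have h1 := c.2.1.eq_of_le ⟨hU, hUi⟩ hHU
    have h2 := d.2.1.eq_of_le ⟨hU, hUi⟩ hKU
    rw [Subtype.ext (h1.trans h2.symm)]
  · exact absurd hHU (key c f hf (Graph.IsSubgraph.edgeSet_mono hKU hfK))
  · exact absurd hKU (key d e he (Graph.IsSubgraph.edgeSet_mono hHU heH))
  · obtain rfl := he.eq_of_inseparable hG hU hUi (Graph.IsSubgraph.edgeSet_mono hHU heH)
      (Graph.IsSubgraph.edgeSet_mono hKU hfK)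
    rw [Subtype.ext (hbu.right_unique hbv)]

theorem bvTree_not_isCycle_inl (hG : PreconnectedOn G (cells G)) {b : V(G)}
    (c : (bvTree G).Walk (Sum.inl b) (Sum.inl b)) : ¬ c.IsCycle := by
  intro hc
  cases c with
  | nil => exact hc.ne_nil rfl
  | @cons _ p _ h w =>
    rw [SimpleGraph.Walk.cons_isCycle_iff] at hc
    obtain ⟨hw, he⟩ := hc
    rw [← SimpleGraph.Walk.isPath_reverse_iff] at hw
    rw [← List.mem_reverse, ← SimpleGraph.Walk.edges_reverse] at he
    revert hw he
    generalize w.reverse = w'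
    intro hw he
    cases w' with
    | nil => exact h.ne rfl
    | @cons _ q _ h' w' =>
      rw [SimpleGraph.Walk.cons_isPath_iff] at hw
      obtain rfl := eq_of_adj_of_reachable hG h' h (reachable_cellOf_of_walk w' hw.2)
      exact he (by simp)

theorem bvTree_isAcyclic (hG : PreconnectedOn G (cells G)) : (bvTree G).IsAcyclic := by
  classical
  rintro (b | b) c hc
  · exact bvTree_not_isCycle_inl hG c hc
  · cases c with
    | nil => exact hc.ne_nil rfl
    | @cons _ p _ h w =>
      obtain ⟨u, rfl, -⟩ := exists_eq_inl_of_adj_inr h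
      have hu : Sum.inl u ∈ (SimpleGraph.Walk.cons h w).support := by simp
      exact bvTree_not_isCycle_inl hG _ (hc.rotate hu)

/-- The vertices of `G` on a segment of the brick-vertex tree separate its ends. -/
theorem separates_of_mem_support (hG : PreconnectedOn G (cells G)) {a b c : V(G)}
    {p : (bvTree G).Walk (Sum.inl a) (Sum.inl c)} (hp : p.IsPath) (hb : Sum.inl b ∈ p.support) :
    Separates G (b : α) a c := by
  classical
  obtain ⟨p₁, p₂, rfl⟩ := SimpleGraph.Walk.mem_support_iff_exists_append.1 hb
  have hp₁ := hp.of_append_left.reverse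
  have hp₂ := hp.of_append_right
  have hne : ∀ q ∈ p₁.reverse.support, q ∈ p₂.support → q = Sum.inl b := by
    intro q hq hq'
    rw [SimpleGraph.Walk.support_reverse, List.mem_reverse] at hq
    by_contra hqb
    exact hp.ne_of_mem_support_of_append hqb hq hq' rfl
  generalize p₁.reverse = w₁ at hp₁ hne
  cases w₁ with
  | nil => exact Or.inl rfl
  | @cons _ q₁ _ h₁ w₁ =>
    cases p₂ with
    | nil => exact Or.inr (Or.inl rfl)
    | @cons _ q₂ _ h₂ w₂ =>
      refine Or.inr (Or.inr fun h => ?_)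
      rw [SimpleGraph.Walk.cons_isPath_iff] at hp₁ hp₂
      have e : q₁ = q₂ := eq_of_adj_of_reachable hG h₁ h₂
        ((reachable_cellOf_of_walk w₁ hp₁.2).trans
          (SimpleGraph.Reachable.trans h (reachable_cellOf_of_walk w₂ hp₂.2).symm))
      subst e
      exact h₁.ne (hne q₁ (by simp) (by simp)).symm

/-- Three distinct vertices of a brick do not separate each other. -/
theorem not_separates_of_mem_brick {H : Graph α β} (h : IsBrick G H) {u v w : α} (hu : u ∈ V(H))
    (hw : w ∈ V(H)) (huv : v ≠ u) (hvw : v ≠ w) : ¬ Separates G v u w := by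
  rintro (h' | h' | h')
  · exact huv h'
  · exact hvw h'
  · exact h' (reachable_of_mem_brick h (inl_mem_cells.2 hu) (inl_mem_cells.2 hw)
      (by simpa using huv.symm) (by simpa using hvw.symm))

theorem bvTree_reachable_of_inc (hV : V(G).Finite) (hE : E(G).Finite) {e : β} {u v : V(G)}
    (hu : G.Inc e u) (hv : G.Inc e v) : (bvTree G).Reachable (Sum.inl u) (Sum.inl v) := by
  by_cases huv : u = v
  · rw [huv]
  by_cases he : IsBridge G e
  · refine SimpleGraph.Adj.reachable (bvTree_adj_inl_inl.2 ⟨huv, e, he, ?_⟩)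
    refine Graph.isLink_iff_inc.2 ⟨hu, hv, fun z hz => ?_⟩
    rcases hu.eq_or_eq_or_eq hv hz with h | h | h
    · exact absurd (Subtype.ext h) huv
    · exact Or.inl h.symm
    · exact Or.inr h.symm
  · obtain ⟨H, hH, heH⟩ := exists_isBrick hV hE hu.edge_mem he
    have key : ∀ {w : V(G)}, G.Inc e w → (bvTree G).Adj (Sum.inl w) (Sum.inr ⟨H, hH⟩) :=
      fun hw => bvTree_adj_inl_inr.2 ((Graph.IsSubgraph.inc_congr hH.le heH).2 hw).vertex_mem
    exact (key hu).reachable.trans (key hv).symm.reachable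

theorem bvTree_reachable (hV : V(G).Finite) (hE : E(G).Finite) (hG : PreconnectedOn G (cells G))
    (u v : V(G)) : (bvTree G).Reachable (Sum.inl u) (Sum.inl v) := by
  have := reachable_mem_of_closed (R := {p : α ⊕ β | ∀ w : V(G), (p = Sum.inl (w : α) ∨
    ∃ e, p = Sum.inr e ∧ G.Inc e w) → (bvTree G).Reachable (Sum.inl u) (Sum.inl w)}) ?_
    (hG (Sum.inl (u : α)) (inl_mem_cells.2 u.2) (Sum.inl (v : α)) (inl_mem_cells.2 v.2)) ?_
  · exact this v (Or.inl rfl)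
  · intro p q hpq hp w hw
    obtain ⟨-, -, x, e, hx, ⟨rfl, rfl⟩ | ⟨rfl, rfl⟩⟩ := cellGraph_adj.1 hpq
    · rcases hw with h | ⟨f, h, hw⟩
      · cases h
      · cases h
        exact (hp ⟨x, hx.vertex_mem⟩ (Or.inl rfl)).trans (bvTree_reachable_of_inc hV hE hx hw)
    · rcases hw with h | ⟨f, h, -⟩
      · obtain rfl := Sum.inl_injective h
        exact hp w (Or.inr ⟨e, rfl, hx⟩)
      · cases h
  · rintro w (h | ⟨f, h, -⟩)
    · rw [Subtype.ext (Sum.inl_injective h)]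
    · cases h

end BrickVertexTree

/-! ### Convex hulls in a forest -/

section ConvexHull

variable {W : Type uW} {T : SimpleGraph W} {S : Set W}

theorem subgraph_coe_reachable (H : T.Subgraph) {u v : W} (p : T.Walk u v) (hu : u ∈ H.verts)
    (hp : ∀ a b, s(a, b) ∈ p.edges → H.Adj a b) :
    ∃ hv : v ∈ H.verts, H.coe.Reachable ⟨u, hu⟩ ⟨v, hv⟩ := by
  induction p with
  | nil => exact ⟨hu, SimpleGraph.Reachable.refl _⟩
  | @cons u x v h p ih =>
    have hux : H.Adj u x := hp _ _ (by simp)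
    obtain ⟨hv, hr⟩ := ih (H.edge_vert hux.symm) fun a b hab => hp a b (by simp [hab])
    exact ⟨hv, SimpleGraph.Reachable.trans (SimpleGraph.Adj.reachable (G := H.coe)
      (show H.coe.Adj ⟨u, hu⟩ ⟨x, _⟩ from hux)) hr⟩

theorem sum_edges_map_hom (H : T.Subgraph) {u v : H.verts} (p : H.coe.Walk u v)
    (f : Sym2 W → ℝ) : ((p.map H.hom).edges.map f).sum =
      (p.edges.map fun e => f (e.map Subtype.val)).sum := by
  rw [SimpleGraph.Walk.edges_map, List.map_map]
  rfl

theorem convexHull_coe_isTree (hT : T.IsAcyclic) (hS : S.Nonempty)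
    (hr : ∀ x ∈ S, ∀ y ∈ S, T.Reachable x y) : (convexHull T S).coe.IsTree := by
  classical
  obtain ⟨x₀, hx₀⟩ := hS
  have key : ∀ w : (convexHull T S).verts, (convexHull T S).coe.Reachable
      ⟨x₀, subset_convexHull T S hx₀⟩ w := by
    rintro ⟨w, x, hx, y, hy, p, hp, hw⟩
    obtain ⟨q, hq⟩ := (hr x₀ hx₀ x hx).exists_isPath
    obtain ⟨_, h1⟩ := subgraph_coe_reachable (convexHull T S) q (subset_convexHull T S hx₀)
      fun a b hab => ⟨x₀, hx₀, x, hx, q, hq, hab⟩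
    obtain ⟨_, h2⟩ := subgraph_coe_reachable (convexHull T S) (p.takeUntil w hw)
      (subset_convexHull T S hx) fun a b hab =>
        ⟨x, hx, y, hy, p, hp, p.edges_takeUntil_subset_edges hw hab⟩
    exact h1.trans h2
  have : Nonempty (convexHull T S).verts := ⟨⟨x₀, subset_convexHull T S hx₀⟩⟩
  exact ⟨⟨fun u v => (key u).symm.trans (key v)⟩, hT.subgraph _⟩

/-- The leaves of the convex hull of `S` belong to `S`. -/
theorem two_le_valency_convexHull [Finite W] (w : (convexHull T S).verts) (hw : (w : W) ∉ S) :
    2 ≤ valency (convexHull T S).coe w := by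
  obtain ⟨w, x, hx, y, hy, p, hp, hwp⟩ := w
  obtain ⟨p₁, p₂, rfl⟩ := SimpleGraph.Walk.mem_support_iff_exists_append.1 hwp
  have hne : ∀ q ∈ p₁.reverse.support, q ∈ p₂.support → q = w := by
    intro q hq hq'
    rw [SimpleGraph.Walk.support_reverse, List.mem_reverse] at hq
    by_contra hqb
    exact hp.ne_of_mem_support_of_append hqb hq hq' rfl
  have hadj : ∀ a b, s(a, b) ∈ p₁.reverse.edges ∨ s(a, b) ∈ p₂.edges →
      (convexHull T S).Adj a b := fun a b hab =>
    ⟨x, hx, y, hy, _, hp, by simpa [SimpleGraph.Walk.edges_append] using hab⟩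
  generalize p₁.reverse = w₁ at hne hadj
  cases w₁ with
  | nil => exact absurd hx hw
  | @cons _ a _ h₁ w₁ =>
    cases p₂ with
    | nil => exact absurd hy hw
    | @cons _ b _ h₂ w₂ =>
      have ha : (convexHull T S).Adj w a := hadj _ _ (Or.inl (by simp))
      have hb : (convexHull T S).Adj w b := hadj _ _ (Or.inr (by simp))
      refine (Set.one_lt_ncard (Set.toFinite _)).2 ⟨⟨a, (convexHull T S).edge_vert ha.symm⟩, ha,
        ⟨b, (convexHull T S).edge_vert hb.symm⟩, hb, fun hab => ?_⟩
      obtain rfl : a = b := congrArg Subtype.val hab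
      exact h₁.ne (hne a (by simp) (by simp)).symm

end ConvexHull

/-! ### Lengths on the hull -/

/-- A metric space with at most three points, none of which lies between two others, embeds
in a star whose leaves are its points: for three points, the radii are the Gromov products. -/
theorem exists_star_lengths {V : Type uX} [MetricSpace V] {N : Set V} (hN : N.Finite)
    (h3 : N.ncard ≤ 3) (hb : ∀ a ∈ N, ∀ b ∈ N, ∀ c ∈ N, b ≠ a → b ≠ c → a ≠ c →
      dist a b + dist b c ≠ dist a c) :
    ∃ r : V → ℝ, (∀ u ∈ N, 0 < r u) ∧ ∀ u ∈ N, ∀ v ∈ N, u ≠ v → r u + r v = dist u v := by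
  classical
  have hcard : N.ncard = 0 ∨ N.ncard = 1 ∨ N.ncard = 2 ∨ N.ncard = 3 := by omega
  rcases hcard with h | h | h | h
  · rw [Set.ncard_eq_zero hN] at h
    exact ⟨fun _ => 1, by simp [h], by simp [h]⟩
  · obtain ⟨a, rfl⟩ := Set.ncard_eq_one.1 h
    refine ⟨fun _ => 1, fun _ _ => one_pos, ?_⟩
    rintro u rfl v rfl huv
    exact absurd rfl huv
  · obtain ⟨a, b, hab, rfl⟩ := Set.ncard_eq_two.1 h
    refine ⟨fun _ => dist a b / 2, fun _ _ => half_pos (dist_pos.2 hab), ?_⟩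
    rintro u (rfl | rfl) v (rfl | rfl) huv
    · exact absurd rfl huv
    · exact add_halves _
    · rw [add_halves, dist_comm]
    · exact absurd rfl huv
  · obtain ⟨a, b, c, hab, hac, hbc, rfl⟩ := Set.ncard_eq_three.1 h
    have key : ∀ {x y z : V}, x ∈ ({a, b, c} : Set V) → y ∈ ({a, b, c} : Set V) →
        z ∈ ({a, b, c} : Set V) → x ≠ y → x ≠ z → y ≠ z →
        0 < (dist x y + dist x z - dist y z) / 2 := by
      intro x y z hx hy hz hxy hxz hyz
      have h1 := hb y hy x hx z hz hxy hxz hyz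
      have h2 := lt_of_le_of_ne (dist_triangle y x z) h1.symm
      have h3 := dist_comm x y
      linarith
    have ha' : a ∈ ({a, b, c} : Set V) := by simp
    have hb' : b ∈ ({a, b, c} : Set V) := by simp
    have hc' : c ∈ ({a, b, c} : Set V) := by simp
    refine ⟨fun u => if u = a then (dist a b + dist a c - dist b c) / 2 else
      if u = b then (dist b a + dist b c - dist a c) / 2 else
        (dist c a + dist c b - dist a b) / 2, ?_, ?_⟩
    · rintro u (rfl | rfl | rfl)
      · simpa using key ha' hb' hc' hab hac hbc
      · simpa [hab.symm] using key hb' ha' hc' hab.symm hbc hac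
      · simpa [hac.symm, hbc.symm] using key hc' ha' hb' hac.symm hbc.symm hab
    · have e1 := dist_comm a b
      have e2 := dist_comm a c
      have e3 := dist_comm b c
      rintro u (rfl | rfl | rfl) v (rfl | rfl | rfl) huv <;>
        first
        | exact absurd rfl huv
        | (simp only [if_true, hab.symm, hac.symm, hbc.symm, if_false]; linarith)

section Hull

variable {α : Type uα} {β : Type uβ} {G : Graph α β} [MetricSpace V(G)]

/-- Lengths of the edges of the brick-vertex tree: bridges have the length of the distance of
their ends, and the edge joining a brick-vertex `b` to a vertex `u` has length `r b u`. -/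
noncomputable def bvLength (r : {H : Graph α β // IsBrick G H} → V(G) → ℝ) :
    Sym2 (BVVertex G) → ℝ :=
  Sym2.lift ⟨fun p q => match p, q with
    | Sum.inl u, Sum.inl v => dist u v
    | Sum.inl u, Sum.inr b => r b u
    | Sum.inr b, Sum.inl u => r b u
    | Sum.inr _, Sum.inr _ => 0, by
    rintro (u | b) (v | c)
    · exact dist_comm u v
    all_goals rfl⟩

/-- The length of a segment of the brick-vertex tree is the distance of its ends, if this
holds for the pieces of the segment that cross a brick. -/
theorem dist_eq_sum_bvLength (hG : PreconnectedOn G (cells G))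
    (hδ : ∀ a b c : V(G), Separates G (b : α) (a : α) (c : α) → dist a b + dist b c = dist a c)
    {H : (bvTree G).Subgraph} {r : {H : Graph α β // IsBrick G H} → V(G) → ℝ}
    (hr : ∀ b u v, H.Adj (Sum.inr b) (Sum.inl u) → H.Adj (Sum.inr b) (Sum.inl v) → u ≠ v →
      r b u + r b v = dist u v) {a c : V(G)} (p : (bvTree G).Walk (Sum.inl a) (Sum.inl c))
    (hp : p.IsPath) (hH : ∀ x y, s(x, y) ∈ p.edges → H.Adj x y) :
    dist a c = (p.edges.map (bvLength r)).sum := by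
  induction hn : p.length using Nat.strong_induction_on generalizing a with
  | _ n ih =>
    cases p with
    | nil => simp
    | @cons _ x _ h q =>
      rcases x with b | b
      · have hs := hδ a b c (separates_of_mem_support hG hp (by simp))
        rw [SimpleGraph.Walk.cons_isPath_iff] at hp
        have := ih q.length (by simp [← hn]) q hp.1 (fun x y hxy => hH x y (by simp [hxy])) rfl
        rw [← hs, this]
        simp [bvLength]
      · cases q with
        | @cons _ y _ h' q =>
          obtain ⟨v, rfl, -⟩ := exists_eq_inl_of_adj_inr h'
          have hs := hδ a v c (separates_of_mem_support hG hp (by simp))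
          rw [SimpleGraph.Walk.cons_isPath_iff, SimpleGraph.Walk.cons_isPath_iff] at hp
          have hav : a ≠ v := by
            rintro rfl
            exact hp.2 (by simp)
          have := ih q.length (by simp [← hn]) q hp.1.1
            (fun x y hxy => hH x y (by simp [hxy])) rfl
          rw [← hs, this, ← hr b a v (hH _ _ (by simp)).symm (hH _ _ (by simp)) hav]
          simp [bvLength, add_assoc]

theorem isTreeHull_hullTree (hV : V(G).Finite) (hE : E(G).Finite) (hG : IsConnected G)
    (hδ : ∀ a b c : V(G), dist a b + dist b c = dist a c ↔ Separates G (b : α) (a : α) (c : α))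
    {X : Set V(G)} (hX : X.Nonempty)
    (hval : ∀ b : {H : Graph α β // IsBrick G H}, Sum.inr b ∈ (bvHull G X).verts →
      ¬ 4 ≤ ((bvHull G X).neighborSet (Sum.inr b)).ncard) :
    IsTreeHull X (hullTree G X) (hullMark G X) := by
  have hfin : Finite (BVVertex G) := finite_bvVertex hV hE
  have hfinV : Finite V(G) := hV
  have hT : (bvHull G X).coe.IsTree := by
    refine convexHull_coe_isTree (bvTree_isAcyclic hG.2) (hX.image _) ?_
    rintro - ⟨x, -, rfl⟩ - ⟨y, -, rfl⟩
    exact bvTree_reachable hV hE hG.2 x y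
  -- The star at a brick-vertex of the hull: its leaves are at most three vertices of the brick.
  have hstar : ∀ b : {H : Graph α β // IsBrick G H}, ∃ r : V(G) → ℝ,
      (∀ u, (bvHull G X).Adj (Sum.inr b) (Sum.inl u) → 0 < r u) ∧
      ∀ u v, (bvHull G X).Adj (Sum.inr b) (Sum.inl u) → (bvHull G X).Adj (Sum.inr b) (Sum.inl v) →
        u ≠ v → r u + r v = dist u v := by
    intro b
    have hmem : ∀ u, (bvHull G X).Adj (Sum.inr b) (Sum.inl u) → (u : α) ∈ V(b.1) := fun u hu =>
      bvTree_adj_inl_inr.1 ((bvHull G X).adj_sub hu).symm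
    have hcard : {u | (bvHull G X).Adj (Sum.inr b) (Sum.inl u)}.ncard ≤ 3 := by
      by_cases hb : Sum.inr b ∈ (bvHull G X).verts
      · refine le_trans ?_ (Nat.le_of_lt_succ (not_le.1 (hval b hb)))
        rw [← Set.ncard_image_of_injective _ (Sum.inl_injective (β := {H // IsBrick G H}))]
        refine Set.ncard_le_ncard ?_ (Set.toFinite _)
        rintro - ⟨u, hu, rfl⟩
        exact hu
      · have : {u | (bvHull G X).Adj (Sum.inr b) (Sum.inl u)} = ∅ :=
          Set.eq_empty_of_forall_notMem fun u hu => hb ((bvHull G X).edge_vert hu)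
        simp [this]
    obtain ⟨r, h1, h2⟩ := exists_star_lengths (Set.toFinite _) hcard
      fun u hu v hv w hw hvu hvw _ h => not_separates_of_mem_brick b.2 (hmem u hu) (hmem w hw)
        (fun e => hvu (Subtype.ext e)) (fun e => hvw (Subtype.ext e)) ((hδ u v w).1 h)
    exact ⟨r, h1, fun u v hu hv => h2 u hu v hv⟩
  choose r hr0 hr using hstar
  have hrange : hullMarks G X = Set.range fun x : X =>
      (⟨Sum.inl x.1, subset_convexHull _ _ ⟨x.1, x.2, rfl⟩⟩ : (bvHull G X).verts) := by
    ext ⟨w, hw⟩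
    constructor
    · rintro ⟨x, hx, rfl⟩
      exact ⟨⟨x, hx⟩, rfl⟩
    · rintro ⟨x, hx⟩
      exact ⟨x.1, x.2, congrArg Subtype.val hx⟩
  refine isTreeHull_smoothing (ℓ := fun e => bvLength r (e.map Subtype.val)) hT ⟨?_, ?_⟩ ?_ hrange
    ?_ (hullMark G X) fun x => rfl
  · intro e
    induction e with
    | h p q =>
      intro h
      have h : (bvHull G X).Adj (p : BVVertex G) q := (SimpleGraph.mem_edgeSet _).1 h
      obtain ⟨p | b, hp⟩ := p <;> obtain ⟨q | c, hq⟩ := q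
      · exact dist_pos.2 (bvTree_adj_inl_inl.1 ((bvHull G X).adj_sub h)).1
      · exact hr0 c p h.symm
      · exact hr0 b q h
      · exact absurd ((bvHull G X).adj_sub h) bvTree_not_adj_inr_inr
  · intro x y p hp
    have hpath : (p.map (bvHull G X).hom).IsPath :=
      SimpleGraph.Walk.IsPath.map (bvHull G X).hom_injective hp
    have := dist_eq_sum_bvLength hG.2 (fun a b c => (hδ a b c).2) hr (p.map (bvHull G X).hom)
      hpath fun u v huv => ⟨_, ⟨x.1, x.2, rfl⟩, _, ⟨y.1, y.2, rfl⟩, _, hpath, huv⟩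
    exact this.trans (sum_edges_map_hom _ p _)
  · intro x y hxy
    exact Subtype.ext (Sum.inl_injective (congrArg Subtype.val hxy))
  · intro w hw
    refine two_le_valency_convexHull w fun h => hw ?_
    rw [← hrange]
    exact h

end Hull

end BrickVertex

theorem theorem10p1 {α : Type uα} {β : Type uβ} (G : Graph α β)
    (hV : V(G).Finite) (hE : E(G).Finite) (hG : BrickVertex.IsConnected G)
    [MetricSpace V(G)]
    (hδ : ∀ a b c : V(G),
      dist a b + dist b c = dist a c ↔ BrickVertex.Separates G (b : α) (a : α) (c : α))
    (X : Set V(G)) (hX : X.Nonempty)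
    (hval : ∀ b : {H : Graph α β // BrickVertex.IsBrick G H},
      Sum.inr b ∈ (BrickVertex.bvHull G X).verts →
        ¬ 4 ≤ ((BrickVertex.bvHull G X).neighborSet (Sum.inr b)).ncard) :
    BrickVertex.FourPointsCondition X ∧
    BrickVertex.IsTreeHull X (BrickVertex.hullTree G X) (BrickVertex.hullMark G X) ∧
    ∀ (W : Type uW) (T : SimpleGraph W) (ι : X → W), BrickVertex.IsTreeHull X T ι →
      BrickVertex.XTreeIso T ι (BrickVertex.hullTree G X) (BrickVertex.hullMark G X) := by
  have h := BrickVertex.isTreeHull_hullTree hV hE hG hδ hX hval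
  exact ⟨h.fourPointsCondition, h, fun _ _ _ hT => hT.xTreeIso h⟩
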